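/- Conventions. The $n$-qubit Pauli group consists of the operators $\alpha\,P_1\otimes\cdots\otimes P_n$ on $(\mathbb{C}^2)^{\otimes n}$ with $\alpha\in\{\pm1,\pm i\}$ and $P_j\in\{I,X,Y,Z\}$; the support of such an operator is the set of qubits $j$ with $P_j\neq I$, and its weight is the size of its support. An $[[n,k,d]]$ stabilizer code is given by an abelian subgroup $\mathcal{S}$ of the $n$-qubit Pauli group with $-I\notin\mathcal{S}$, together with a fixed family $S_1,\dots,S_{n-k}$ of independent generators of $\mathcal{S}$ (none lies in the subgroup generated by the others). Its codewords are the states fixed by all elements of $\mathcal{S}$, and its distance $d$ is the minimum weight of a Pauli operator $E$ that maps some codeword to another codeword (a different state, that is, not a scalar multiple of the first). A 2D-embedding is a map from the $n$ qubits to $\mathbb{R}^2$ such that any two distinct qubits are mapped to points at Euclidean distance at least $1$. An interaction is an unordered pair of distinct qubits that are both in the support of the same generator $S_i$; its length is the distance between the two embedded qubits. Theorem. There exist absolute constants $c_0,c_1>0$ such that the following holds. For every $[[n,k,d]]$ stabilizer code with $kd^2\ge c_1\cdot n$, every 2D-embedding of it has at least $c_0\cdot\max(k,d)$ interactions of length at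 least $c_0\cdot\max\left(\frac{d}{\sqrt{n}},\left(\frac{kd^2}{n}\right)^{1/4}\right)$. -/

import Mathlib

/-! ### The Pauli group on `n` qubits -/

/-- An element of the `n`-qubit Pauli group (tensor products of `I, X, Y, Z`, with scalar
factors `±1, ±i`), written in its unique normal form `i ^ phase • X^x Z^z`, where `X^x` is the
product of the `X_j` with `x j = 1`, and `Z^z` the product of the `Z_j` with `z j = 1`.
The tensor factor at qubit `j` is, up to a scalar, `I`, `X`, `Z` or `Y = i X Z`
for `(x j, z j) = (0,0), (1,0), (0,1), (1,1)`. -/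
@[ext]
structure PauliGroup (n : ℕ) where
  phase : ZMod 4
  x : Fin n → ZMod 2
  z : Fin n → ZMod 2

namespace PauliGroup

/-- The map `ZMod 2 → ZMod 4`, `b ↦ 2 b`, so that `i ^ (twice b) = (-1) ^ b`. -/
def twice (b : ZMod 2) : ZMod 4 := 2 * (b.val : ZMod 4)

theorem twice_add : ∀ b c : ZMod 2, twice (b + c) = twice b + twice c := by decide

theorem twice_neg : ∀ b : ZMod 2, twice (-b) = twice b := by decide

theorem twice_zero : twice 0 = 0 := by decide

theorem twice_add_self : ∀ b : ZMod 2, twice b + twice b = 0 := by decide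

variable {n : ℕ}

instance : One (PauliGroup n) := ⟨⟨0, 0, 0⟩⟩

/-- Multiplication of Pauli operators, from `Z^z X^x = (-1)^(z ⬝ x) X^x Z^z`. -/
instance : Mul (PauliGroup n) :=
  ⟨fun P R => ⟨P.phase + R.phase + twice (P.z ⬝ᵥ R.x), P.x + R.x, P.z + R.z⟩⟩

instance : Inv (PauliGroup n) :=
  ⟨fun P => ⟨-P.phase + twice (P.z ⬝ᵥ P.x), -P.x, -P.z⟩⟩

/-- The scalar operator `-I`. -/
instance : Neg (PauliGroup n) := ⟨fun P => ⟨P.phase + 2, P.x, P.z⟩⟩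

@[simp] theorem one_phase : (1 : PauliGroup n).phase = 0 := rfl
@[simp] theorem one_x : (1 : PauliGroup n).x = 0 := rfl
@[simp] theorem one_z : (1 : PauliGroup n).z = 0 := rfl
@[simp] theorem mul_phase (P R : PauliGroup n) :
    (P * R).phase = P.phase + R.phase + twice (P.z ⬝ᵥ R.x) := rfl
@[simp] theorem mul_x (P R : PauliGroup n) : (P * R).x = P.x + R.x := rfl
@[simp] theorem mul_z (P R : PauliGroup n) : (P * R).z = P.z + R.z := rfl
@[simp] theorem inv_phase (P : PauliGroup n) :
    (P⁻¹).phase = -P.phase + twice (P.z ⬝ᵥ P.x) := rfl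
@[simp] theorem inv_x (P : PauliGroup n) : (P⁻¹).x = -P.x := rfl
@[simp] theorem inv_z (P : PauliGroup n) : (P⁻¹).z = -P.z := rfl

instance : Group (PauliGroup n) :=
  Group.ofLeftAxioms
    (by
      intro P R T
      ext
      · simp only [mul_phase, mul_x, mul_z, add_dotProduct, dotProduct_add, twice_add]
        ring
      · simp [add_assoc]
      · simp [add_assoc])
    (by
      intro P
      ext <;> simp [twice_zero])
    (by
      intro P
      ext
      · simp only [mul_phase, inv_phase, inv_z, neg_dotProduct, twice_neg, one_phase]
        have h := twice_add_self (P.z ⬝ᵥ P.x)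
        linear_combination h
      · simp only [mul_x, inv_x, neg_add_cancel, one_x]
      · simp only [mul_z, inv_z, neg_add_cancel, one_z])

/-- The set of qubits on which the tensor factor of `P` is not a multiple of the identity. -/
def support (P : PauliGroup n) : Finset (Fin n) :=
  Finset.univ.filter fun j => P.x j ≠ 0 ∨ P.z j ≠ 0

/-- The weight of a Pauli operator: the number of qubits on which it acts nontrivially. -/
def weight (P : PauliGroup n) : ℕ := P.support.card

end PauliGroup

/-- The state space `(ℂ²)^{⊗ n}` of `n` qubits, in coordinates with respect to the computational
basis `|y⟩`, `y ∈ {0,1}^n`. -/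
abbrev QubitSpace (n : ℕ) : Type := (Fin n → ZMod 2) → ℂ

namespace PauliGroup

variable {n : ℕ}

/-- The operator `i ^ phase • X^x Z^z` on `(ℂ²)^{⊗ n}`; it maps the basis vector `|y⟩` to
`i ^ phase * (-1) ^ (z ⬝ y)` times the basis vector `|y + x⟩`. -/
noncomputable def operator (P : PauliGroup n) : QubitSpace n →ₗ[ℂ] QubitSpace n where
  toFun ψ := fun y =>
    Complex.I ^ P.phase.val * (-1 : ℂ) ^ (P.z ⬝ᵥ (y - P.x)).val * ψ (y - P.x)
  map_add' ψ φ := by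
    funext y
    simp only [Pi.add_apply]
    ring
  map_smul' c ψ := by
    funext y
    simp only [Pi.smul_apply, smul_eq_mul, RingHom.id_apply]
    ring

end PauliGroup

/-! ### Stabilizer codes -/

/-- A stabilizer code on `n` qubits of dimension `k`: a stabilizer group (an abelian subgroup of
the Pauli group that does not contain `-I`) together with a fixed family of `n - k` independent
generators of it. -/
structure StabilizerCode (n k : ℕ) where
  /-- the stabilizer group -/
  stab : Subgroup (PauliGroup n)
  comm : ∀ P ∈ stab, ∀ R ∈ stab, P * R = R * P
  neg_one_notMem : (-1 : PauliGroup n) ∉ stab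
  k_le : k ≤ n
  /-- the fixed generators -/
  gen : Fin (n - k) → PauliGroup n
  closure_gen : Subgroup.closure (Set.range gen) = stab
  /-- no generator lies in the group generated by the other ones -/
  gen_indep : ∀ i, gen i ∉ Subgroup.closure (gen '' {j | j ≠ i})

namespace StabilizerCode

variable {n k : ℕ}

/-- The code space: the vectors fixed by every element of the stabilizer group. -/
def codeSpace (C : StabilizerCode n k) : Submodule ℂ (QubitSpace n) where
  carrier := {ψ | ∀ P ∈ C.stab, P.operator ψ = ψ}
  add_mem' hψ hφ P hP := by rw [map_add, hψ P hP, hφ P hP]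
  zero_mem' P _ := map_zero _
  smul_mem' c ψ hψ P hP := by rw [map_smul, hψ P hP]

/-- `E` maps some codeword to another codeword, i.e. to a codeword that is a different state.
Vectors that are proportional describe the same state. -/
def IsLogicalError (C : StabilizerCode n k) (E : PauliGroup n) : Prop :=
  ∃ ψ ∈ C.codeSpace, E.operator ψ ∈ C.codeSpace ∧ ∀ c : ℂ, E.operator ψ ≠ c • ψ

/-- The code has distance `d`: the minimum weight of an error that maps a codeword to another
codeword is `d`. -/
def HasDistance (C : StabilizerCode n k) (d : ℕ) : Prop :=
  IsLeast {w | ∃ E : PauliGroup n, C.IsLogicalError E ∧ E.weight = w} d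

end StabilizerCode

/-! ### Embeddings in the plane and interactions -/

/-- A 2D-embedding of `n` qubits: distinct qubits are at Euclidean distance at least `1`. -/
def IsTwoDEmbedding {n : ℕ} (e : Fin n → EuclideanSpace ℝ (Fin 2)) : Prop :=
  ∀ p q : Fin n, p ≠ q → 1 ≤ dist (e p) (e q)

namespace StabilizerCode

variable {n k : ℕ}

/-- The qubits `p` and `q` form an interaction: they are distinct, and some one of the fixed
generators has both of them in its support. -/
def Interacts (C : StabilizerCode n k) (p q : Fin n) : Prop :=
  p ≠ q ∧ ∃ i, p ∈ (C.gen i).support ∧ q ∈ (C.gen i).support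

/-- The interactions of length at least `ℓ`. An interaction is an unordered pair of qubits;
each is listed once, as the pair `(p, q)` with `p < q`. -/
def longInteractions (C : StabilizerCode n k) (e : Fin n → EuclideanSpace ℝ (Fin 2)) (ℓ : ℝ) :
    Set (Fin n × Fin n) :=
  {pq | pq.1 < pq.2 ∧ C.Interacts pq.1 pq.2 ∧ ℓ ≤ dist (e pq.1) (e pq.2)}

end StabilizerCode

/-!
Up to phase, Pauli operators form the symplectic space `𝔽₂²ⁿ` (`PauliVec`), and the stabilizers an
isotropic subspace `S` of dimension `n - k`. Write `L(M)` (`PauliVec.logicalSpan`) for `S` together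
with the operators on a region `M` that commute with `S`; `M` is correctable if `L(M) = S`. The
proof rests on these facts:

* `L(M)` and `L(Mᶜ)` are each other's orthogonal space, so `dim L(M) + dim L(Mᶜ) = 2 n`
  (`PauliVec.finrank_logicalSpan_add_compl`), and enlarging `M` by one qubit raises `dim L(M)` by at
  most `2`. If `dim L(M)` and `dim L(Mᶜ)` exceed `n - k` by at most `a` and `b`, then
  `2 k ≤ a + b`.
* Regions with fewer than `d` qubits are correctable (`StabilizerCode.HasDistance.correctable`).
* If `U` is correctable and the generators that meet `U` lie in `U ∪ T`, then `L(U ∪ T) = L(T)`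
  (`PauliVec.logicalSpan_union_le`): operators can be cleaned off `U`, into `T`.
* Correctable regions of which no generator meets two have a correctable union
  (`PauliVec.Correctable.of_fibers`).

Let `ℓ` be the interaction length in the theorem, up to a constant, and call a qubit bad if it is in
an interaction of length at least `ℓ`. If there are too few such interactions, fewer than
`max k d / 50` qubits are bad. A generator that contains a good qubit is local. Divide the plane
into square cells of side about `ℓ`, so that a cell has `O(ℓ²)` qubits, and draw a grid with a
line in every `N`-th row and column of cells, where `N` is of the order of `d / ℓ²`, so that a box
has fewer than `d` qubits on its perimeter. By cleaning, applied to one column after the other, the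
good part of a box is correctable if the box has few bad qubits (`CellLayout.correctable_rect`), and
so is the union of these over all boxes. The good qubits on the grid lines away from the crossings
are correctable too. In all cases, averaging over the translates of the grid bounds the number of
exceptional qubits.

* If `k n ≤ d²`, then for some translate fewer than `d` qubits are bad or on the grid. So the good
  interiors of the boxes and their complement are both correctable, and `k = 0`
  (`CellLayout.eq_zero_of_few_on_grid`).
* If `k n > d²` and `k ≤ d`, then the bad qubits are correctable as a set, and those away from the
  grid lines can be cleaned into the good interiors. Only the crossings and the bad qubits near the
  grid lines contribute to the bound on `k`, and these are fewer than `k`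
  (`CellLayout.mul_sq_le_of_card_bad_le`).
* If `k > d`, the boxes may contain too many bad qubits to be correctable. But they can be cut into
  slabs by deleting no more good qubits than there are bad ones
  (`CellLayout.exists_correctable_subset_rect`), and all bad and deleted qubits together are too few
  to account for `k` (`CellLayout.mul_sq_le`).
-/

/-! ### Pauli operators up to phase as a symplectic space -/

/-- Pauli operators on `n` qubits up to phase: `(x, z)` stands for `X^x Z^z`. -/
abbrev PauliVec (n : ℕ) : Type := (Fin n → ZMod 2) × (Fin n → ZMod 2)

/-- The symplectic form on Pauli operators up to phase: it vanishes exactly on commuting pairs. -/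
noncomputable def symplecticForm (n : ℕ) : LinearMap.BilinForm (ZMod 2) (PauliVec n) :=
  LinearMap.mk₂ (ZMod 2) (fun v w => v.2 ⬝ᵥ w.1 + v.1 ⬝ᵥ w.2)
    (by intros; simp only [Prod.fst_add, Prod.snd_add, add_dotProduct]; ring)
    (by intros; simp only [Prod.smul_fst, Prod.smul_snd, smul_dotProduct, smul_add])
    (by intros; simp only [Prod.fst_add, Prod.snd_add, dotProduct_add]; ring)
    (by intros; simp only [Prod.smul_fst, Prod.smul_snd, dotProduct_smul, smul_add])

namespace PauliVec

variable {n : ℕ}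

theorem symplecticForm_apply (v w : PauliVec n) :
    symplecticForm n v w = v.2 ⬝ᵥ w.1 + v.1 ⬝ᵥ w.2 := rfl

theorem symplecticForm_eq_sum (v w : PauliVec n) :
    symplecticForm n v w = ∑ j, (v.2 j * w.1 j + v.1 j * w.2 j) := by
  rw [symplecticForm_apply, Finset.sum_add_distrib]; rfl

theorem symplecticForm_comm (v w : PauliVec n) :
    symplecticForm n v w = symplecticForm n w v := by
  simp only [symplecticForm_apply]
  rw [dotProduct_comm v.2, dotProduct_comm v.1, add_comm]

theorem symplecticForm_isRefl : (symplecticForm n).IsRefl := fun v w h => by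
  rwa [symplecticForm_comm]

theorem symplecticForm_nondegenerate : (symplecticForm n).Nondegenerate := by
  have key : ∀ v : PauliVec n, (∀ w, symplecticForm n v w = 0) → v = 0 := by
    intro v hv
    have h1 : v.1 = 0 := by
      funext j
      simpa [symplecticForm_apply] using hv (0, Pi.single j 1)
    have h2 : v.2 = 0 := by
      funext j
      simpa [symplecticForm_apply] using hv (Pi.single j 1, 0)
    exact Prod.ext h1 h2
  exact ⟨key, fun v hv => key v fun w => by rw [symplecticForm_comm]; exact hv w⟩

/-- The qubits on which a Pauli operator up to phase acts nontrivially. -/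
def supp (v : PauliVec n) : Finset (Fin n) :=
  Finset.univ.filter fun j => v.1 j ≠ 0 ∨ v.2 j ≠ 0

theorem mem_supp {v : PauliVec n} {j : Fin n} : j ∈ v.supp ↔ v.1 j ≠ 0 ∨ v.2 j ≠ 0 := by
  simp [supp]

theorem notMem_supp {v : PauliVec n} {j : Fin n} : j ∉ v.supp ↔ v.1 j = 0 ∧ v.2 j = 0 := by
  rw [mem_supp]; tauto

/-- The Pauli operators up to phase supported on a region `M`. -/
def supportedOn (M : Finset (Fin n)) : Submodule (ZMod 2) (PauliVec n) where
  carrier := {v | ∀ j ∉ M, v.1 j = 0 ∧ v.2 j = 0}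
  add_mem' hv hw j hj := by simp [hv j hj, hw j hj]
  zero_mem' := by simp
  smul_mem' c v hv j hj := by simp [hv j hj]

theorem mem_supportedOn {M : Finset (Fin n)} {v : PauliVec n} :
    v ∈ supportedOn M ↔ ∀ j ∉ M, v.1 j = 0 ∧ v.2 j = 0 := Iff.rfl

theorem mem_supportedOn_iff_supp {M : Finset (Fin n)} {v : PauliVec n} :
    v ∈ supportedOn M ↔ v.supp ⊆ M := by
  simp only [mem_supportedOn, ← notMem_supp, Finset.subset_iff]
  exact forall_congr' fun j => not_imp_not

theorem supportedOn_mono {M N : Finset (Fin n)} (h : M ⊆ N) : supportedOn M ≤ supportedOn N :=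
  fun _ hv j hj => hv j fun hj' => hj (h hj')

theorem symplecticForm_eq_zero_of_disjoint {v w : PauliVec n} (h : Disjoint v.supp w.supp) :
    symplecticForm n v w = 0 := by
  rw [symplecticForm_eq_sum]
  refine Finset.sum_eq_zero fun j _ => ?_
  by_cases hj : j ∈ v.supp
  · obtain ⟨h1, h2⟩ := notMem_supp.1 (Finset.disjoint_left.1 h hj)
    simp [h1, h2]
  · obtain ⟨h1, h2⟩ := notMem_supp.1 hj
    simp [h1, h2]

theorem orthogonal_supportedOn (M : Finset (Fin n)) :
    (symplecticForm n).orthogonal (supportedOn M) = supportedOn Mᶜ := by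
  ext v
  rw [LinearMap.BilinForm.mem_orthogonal_iff]
  constructor
  · intro h j hj
    rw [Finset.notMem_compl] at hj
    have hne : ∀ i ∉ M, i ≠ j := fun i hi e => hi (e ▸ hj)
    have h1 : symplecticForm n (0, Pi.single j 1) v = 0 := h _ fun i hi => by simp [hne i hi]
    have h2 : symplecticForm n (Pi.single j 1, 0) v = 0 := h _ fun i hi => by simp [hne i hi]
    exact ⟨by simpa [symplecticForm_apply] using h1, by simpa [symplecticForm_apply] using h2⟩
  · intro hv w hw
    apply symplecticForm_eq_zero_of_disjoint
    rw [mem_supportedOn_iff_supp] at hv hw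
    exact Disjoint.mono hw hv (disjoint_compl_right : Disjoint M Mᶜ)

theorem finrank_pauliVec : Module.finrank (ZMod 2) (PauliVec n) = 2 * n := by
  rw [Module.finrank_prod, Module.finrank_fin_fun, two_mul]

theorem finrank_supportedOn_le (M : Finset (Fin n)) :
    Module.finrank (ZMod 2) (supportedOn M) ≤ 2 * M.card := by
  let f : supportedOn M →ₗ[ZMod 2] ((M → ZMod 2) × (M → ZMod 2)) :=
    { toFun := fun v => (fun j => v.1.1 j, fun j => v.1.2 j)
      map_add' := fun _ _ => rfl
      map_smul' := fun _ _ => rfl }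
  have hf : Function.Injective f := by
    rw [← LinearMap.ker_eq_bot, LinearMap.ker_eq_bot']
    rintro ⟨v, hv⟩ h
    have h1 : ∀ j (hj : j ∈ M), v.1 j = 0 := fun j hj => congrFun (congrArg Prod.fst h) ⟨j, hj⟩
    have h2 : ∀ j (hj : j ∈ M), v.2 j = 0 := fun j hj => congrFun (congrArg Prod.snd h) ⟨j, hj⟩
    ext j
    · by_cases hj : j ∈ M
      · exact h1 j hj
      · exact (hv j hj).1
    · by_cases hj : j ∈ M
      · exact h2 j hj
      · exact (hv j hj).2
  have := LinearMap.finrank_le_finrank_of_injective hf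
  rwa [Module.finrank_prod, Module.finrank_pi, Fintype.card_coe, ← two_mul] at this

/-! ### Logical operators and correctable regions -/

/-- The Pauli operators supported on `M` that commute with all of `S`, multiplied by elements
of `S`. Its quotient by `S` is the space of logical operators that `M` supports. -/
noncomputable def logicalSpan (S : Submodule (ZMod 2) (PauliVec n)) (M : Finset (Fin n)) :
    Submodule (ZMod 2) (PauliVec n) :=
  (supportedOn M ⊓ (symplecticForm n).orthogonal S) ⊔ S

/-- A region is correctable if every Pauli operator on it that commutes with the stabilizers is
itself a stabilizer. -/
def Correctable (S : Submodule (ZMod 2) (PauliVec n)) (M : Finset (Fin n)) : Prop :=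
  supportedOn M ⊓ (symplecticForm n).orthogonal S ≤ S

variable {S : Submodule (ZMod 2) (PauliVec n)} {M N U T : Finset (Fin n)}

theorem correctable_iff_logicalSpan_le : Correctable S M ↔ logicalSpan S M ≤ S := by
  simp [Correctable, logicalSpan]

theorem Correctable.logicalSpan_eq (h : Correctable S M) : logicalSpan S M = S :=
  le_antisymm (correctable_iff_logicalSpan_le.1 h) le_sup_right

theorem logicalSpan_mono (h : M ⊆ N) : logicalSpan S M ≤ logicalSpan S N :=
  sup_le_sup_right (inf_le_inf_right _ (supportedOn_mono h)) _

theorem Correctable.mono (hN : Correctable S N) (h : M ⊆ N) : Correctable S M :=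
  (inf_le_inf_right _ (supportedOn_mono h)).trans hN

theorem orthogonal_sup (A B : Submodule (ZMod 2) (PauliVec n)) :
    (symplecticForm n).orthogonal (A ⊔ B) =
      (symplecticForm n).orthogonal A ⊓ (symplecticForm n).orthogonal B := by
  refine le_antisymm (le_inf (LinearMap.BilinForm.orthogonal_le le_sup_left)
    (LinearMap.BilinForm.orthogonal_le le_sup_right)) ?_
  rintro v ⟨hA, hB⟩ w hw
  obtain ⟨a, ha, b, hb, rfl⟩ := Submodule.mem_sup.1 hw
  have h1 : symplecticForm n a v = 0 := hA a ha
  have h2 : symplecticForm n b v = 0 := hB b hb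
  change symplecticForm n (a + b) v = 0
  rw [map_add, LinearMap.add_apply, h1, h2, add_zero]

theorem orthogonal_orthogonal (A : Submodule (ZMod 2) (PauliVec n)) :
    (symplecticForm n).orthogonal ((symplecticForm n).orthogonal A) = A :=
  LinearMap.BilinForm.orthogonal_orthogonal symplecticForm_nondegenerate symplecticForm_isRefl A

theorem orthogonal_inf (A B : Submodule (ZMod 2) (PauliVec n)) :
    (symplecticForm n).orthogonal (A ⊓ B) =
      (symplecticForm n).orthogonal A ⊔ (symplecticForm n).orthogonal B := by
  rw [← orthogonal_orthogonal (_ ⊔ _), orthogonal_sup, orthogonal_orthogonal,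
    orthogonal_orthogonal]

/-- The logical operators on a region and on its complement are each other's commutant. -/
theorem orthogonal_logicalSpan (hS : S ≤ (symplecticForm n).orthogonal S)
    (M : Finset (Fin n)) :
    (symplecticForm n).orthogonal (logicalSpan S M) = logicalSpan S Mᶜ := by
  rw [logicalSpan, logicalSpan, orthogonal_sup, orthogonal_inf, orthogonal_supportedOn,
    orthogonal_orthogonal, sup_comm, sup_inf_assoc_of_le _ hS, sup_comm]

/-- The cleaning lemma in its dimension-counting form. -/
theorem finrank_logicalSpan_add_compl (hS : S ≤ (symplecticForm n).orthogonal S)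
    (M : Finset (Fin n)) :
    Module.finrank (ZMod 2) (logicalSpan S M) + Module.finrank (ZMod 2) (logicalSpan S Mᶜ) =
      2 * n := by
  rw [← orthogonal_logicalSpan hS,
    LinearMap.BilinForm.finrank_orthogonal symplecticForm_nondegenerate, finrank_pauliVec]
  have := Submodule.finrank_le (logicalSpan S M)
  rw [finrank_pauliVec] at this
  omega

theorem finrank_logicalSpan_union_le (M N : Finset (Fin n)) :
    Module.finrank (ZMod 2) (logicalSpan S (M ∪ N)) ≤
      Module.finrank (ZMod 2) (logicalSpan S M) + 2 * N.card := by
  set P := (symplecticForm n).orthogonal S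
  set W := supportedOn (M ∪ N) ⊓ P
  set K := supportedOn M ⊓ P
  have hKW : K ≤ W := inf_le_inf_right _ (supportedOn_mono Finset.subset_union_left)
  -- The elements of `W` vanishing on `N` lie in `K`, and `supportedOn Nᶜ` is the orthogonal of
  -- `supportedOn N`, so that it has codimension at most `2 * N.card`.
  have hle : W ⊓ supportedOn Nᶜ ≤ K := by
    rintro v ⟨⟨h1, h2⟩, h3⟩
    refine ⟨fun j hj => ?_, h2⟩
    by_cases hN : j ∈ N
    · exact h3 j (by simpa using hN)
    · exact h1 j (by simp [hj, hN])
  have e1 := Submodule.finrank_sup_add_finrank_inf_eq W (supportedOn Nᶜ)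
  have e2 := Submodule.finrank_sup_add_finrank_inf_eq W S
  have e3 := Submodule.finrank_sup_add_finrank_inf_eq K S
  have e4 := Submodule.finrank_mono (inf_le_inf_right S hKW)
  have e5 := Submodule.finrank_mono hle
  have e6 := Submodule.finrank_le (W ⊔ supportedOn Nᶜ)
  have e7 := finrank_supportedOn_le N
  have e8 : Module.finrank (ZMod 2) (supportedOn Nᶜ) =
      2 * n - Module.finrank (ZMod 2) (supportedOn N) := by
    rw [← orthogonal_supportedOn,
      LinearMap.BilinForm.finrank_orthogonal symplecticForm_nondegenerate, finrank_pauliVec]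
  have e9 := Submodule.finrank_le (supportedOn N)
  rw [finrank_pauliVec] at e6 e9
  change Module.finrank (ZMod 2) (W ⊔ S : Submodule (ZMod 2) (PauliVec n)) ≤
    Module.finrank (ZMod 2) (K ⊔ S : Submodule (ZMod 2) (PauliVec n)) + 2 * N.card
  omega

/-! ### Cleaning and merging correctable regions -/

section Generators

variable {ι : Type*} {g : ι → PauliVec n}

/-- An operator that commutes with the stabilizers can be moved off a correctable region `U` by
generators that meet `U`. -/
theorem exists_clean (hU : Correctable (Submodule.span (ZMod 2) (Set.range g)) U) {v : PauliVec n}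
    (hv : v ∈ (symplecticForm n).orthogonal (Submodule.span (ZMod 2) (Set.range g))) :
    ∃ s ∈ Submodule.span (ZMod 2) (g '' {i | ¬ Disjoint (g i).supp U}),
      v - s ∈ supportedOn Uᶜ := by
  set S' := Submodule.span (ZMod 2) (g '' {i | ¬ Disjoint (g i).supp U})
  have key : v ∈ S' ⊔ supportedOn Uᶜ := by
    rw [← orthogonal_orthogonal (S' ⊔ _), orthogonal_sup, orthogonal_supportedOn, compl_compl]
    rintro w ⟨hw1, hw2⟩
    -- `w` lies on `U`, so it commutes with the generators that miss `U` as well.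
    have hw : w ∈ Submodule.span (ZMod 2) (Set.range g) := by
      refine hU ⟨hw2, ?_⟩
      change Submodule.span (ZMod 2) (Set.range g) ≤ LinearMap.ker ((symplecticForm n).flip w)
      rw [Submodule.span_le]
      rintro _ ⟨i, rfl⟩
      by_cases hi : Disjoint (g i).supp U
      · exact symplecticForm_eq_zero_of_disjoint
          (hi.mono_right (mem_supportedOn_iff_supp.1 hw2))
      · exact hw1 _ (Submodule.subset_span ⟨i, hi, rfl⟩)
    exact hv w hw
  obtain ⟨s, hs, t, ht, rfl⟩ := Submodule.mem_sup.1 key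
  exact ⟨s, hs, by simpa using ht⟩

/-- If `U` is correctable and every generator that meets `U` lies in `U ∪ T`, then `U` adds no
logical operators to `T`. -/
theorem logicalSpan_union_le
    (hS : Submodule.span (ZMod 2) (Set.range g) ≤
      (symplecticForm n).orthogonal (Submodule.span (ZMod 2) (Set.range g)))
    (hU : Correctable (Submodule.span (ZMod 2) (Set.range g)) U)
    (hT : ∀ i, ¬ Disjoint (g i).supp U → (g i).supp ⊆ U ∪ T) :
    logicalSpan (Submodule.span (ZMod 2) (Set.range g)) (U ∪ T) ≤
      logicalSpan (Submodule.span (ZMod 2) (Set.range g)) T := by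
  refine sup_le ?_ le_sup_right
  rintro v ⟨hv1, hv2⟩
  obtain ⟨s, hs, hvs⟩ := exists_clean hU hv2
  have hsS : s ∈ Submodule.span (ZMod 2) (Set.range g) :=
    Submodule.span_mono (Set.image_subset_range _ _) hs
  have hsU : s ∈ supportedOn (U ∪ T) := by
    refine Submodule.span_le.2 ?_ hs
    rintro _ ⟨i, hi, rfl⟩
    exact mem_supportedOn_iff_supp.2 (hT i hi)
  rw [← sub_add_cancel v s]
  refine Submodule.add_mem_sup ⟨fun j hj => ?_, Submodule.sub_mem _ hv2 (hS hsS)⟩ hsS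
  by_cases hjU : j ∈ U
  · exact hvs j (by simpa using hjU)
  · exact Submodule.sub_mem _ hv1 hsU j (by simp [hj, hjU])

theorem Correctable.union_of_generators
    (hS : Submodule.span (ZMod 2) (Set.range g) ≤
      (symplecticForm n).orthogonal (Submodule.span (ZMod 2) (Set.range g)))
    (hU : Correctable (Submodule.span (ZMod 2) (Set.range g)) U)
    (hT : Correctable (Submodule.span (ZMod 2) (Set.range g)) T)
    (h : ∀ i, ¬ Disjoint (g i).supp U → (g i).supp ⊆ U ∪ T) :
    Correctable (Submodule.span (ZMod 2) (Set.range g)) (U ∪ T) :=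
  correctable_iff_logicalSpan_le.2
    ((logicalSpan_union_le hS hU h).trans (correctable_iff_logicalSpan_le.1 hT))

/-- A region is correctable if it falls into correctable blocks (the fibres of `f`) such that no
generator meets two of them. -/
theorem Correctable.of_fibers {κ : Type*} [DecidableEq κ] (f : Fin n → κ)
    (hM : ∀ c, Correctable (Submodule.span (ZMod 2) (Set.range g)) (M.filter fun j => f j = c))
    (hsep : ∀ i, ∀ p ∈ M, ∀ q ∈ M, p ∈ (g i).supp → q ∈ (g i).supp → f p = f q) :
    Correctable (Submodule.span (ZMod 2) (Set.range g)) M := by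
  rintro v ⟨hv1, hv2⟩
  -- The restriction of `v` to the block with label `c`.
  let r : κ → PauliVec n := fun c =>
    (fun j => if f j = c then v.1 j else 0, fun j => if f j = c then v.2 j else 0)
  have hsum : v = ∑ c ∈ Finset.univ.image f, r c := by
    ext j
    · simp [r, Prod.fst_sum]
    · simp [r, Prod.snd_sum]
  have hr : ∀ c, r c ∈ Submodule.span (ZMod 2) (Set.range g) := by
    intro c
    refine hM c ⟨fun j hj => ?_, ?_⟩
    · by_cases hc : f j = c
      · have : j ∉ M := fun h => hj (by simp [h, hc])
        simp [r, hv1 j this]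
      · simp [r, hc]
    · change Submodule.span (ZMod 2) (Set.range g) ≤
        LinearMap.ker ((symplecticForm n).flip (r c))
      rw [Submodule.span_le]
      rintro _ ⟨i, rfl⟩
      have hvi : symplecticForm n (g i) v = 0 := hv2 _ (Submodule.subset_span ⟨i, rfl⟩)
      change symplecticForm n (g i) (r c) = 0
      by_cases hc : ∃ p ∈ M, p ∈ (g i).supp ∧ f p = c
      · obtain ⟨p, hp, hpi, rfl⟩ := hc
        rw [← hvi, symplecticForm_eq_sum, symplecticForm_eq_sum]
        refine Finset.sum_congr rfl fun j _ => ?_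
        by_cases hj : j ∈ M
        · by_cases hji : j ∈ (g i).supp
          · simp [r, hsep i j hj p hp hji hpi]
          · obtain ⟨h1, h2⟩ := notMem_supp.1 hji
            simp [h1, h2]
        · simp [r, hv1 j hj]
      · apply symplecticForm_eq_zero_of_disjoint
        rw [Finset.disjoint_right]
        intro j hj hji
        by_cases hjM : j ∈ M
        · have hfc : f j ≠ c := fun e => hc ⟨j, hjM, hji, e⟩
          simp [mem_supp, r, hfc] at hj
        · simp [mem_supp, r, hv1 j hjM] at hj
  rw [hsum]
  exact Submodule.sum_mem _ fun c _ => hr c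

end Generators

end PauliVec

/-! ### Stabilizer codes as isotropic subspaces -/

namespace PauliGroup

variable {n : ℕ}

/-- A Pauli operator with its phase forgotten. -/
def vec (P : PauliGroup n) : PauliVec n := (P.x, P.z)

@[simp] theorem vec_one : (1 : PauliGroup n).vec = 0 := rfl

@[simp] theorem vec_mul (P R : PauliGroup n) : (P * R).vec = P.vec + R.vec := rfl

@[simp] theorem vec_inv (P : PauliGroup n) : (P⁻¹).vec = -P.vec := rfl

theorem symplecticForm_vec (P R : PauliGroup n) :
    symplecticForm n P.vec R.vec = P.z ⬝ᵥ R.x + R.z ⬝ᵥ P.x := by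
  rw [PauliVec.symplecticForm_apply, dotProduct_comm R.z]; rfl

theorem commute_iff (P R : PauliGroup n) :
    P * R = R * P ↔ symplecticForm n P.vec R.vec = 0 := by
  have key : ∀ a b : ZMod 2, twice a = twice b ↔ a + b = 0 := by decide
  rw [symplecticForm_vec, ← key, PauliGroup.ext_iff]
  simp [add_comm R.phase, add_comm R.x, add_comm R.z]

theorem mul_eq_neg_mul (P R : PauliGroup n) (h : symplecticForm n P.vec R.vec ≠ 0) :
    P * R = -(R * P) := by
  have key : ∀ a b : ZMod 2, a + b ≠ 0 → twice a = twice b + 2 := by decide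
  rw [symplecticForm_vec] at h
  ext
  · change P.phase + R.phase + twice (P.z ⬝ᵥ R.x) = R.phase + P.phase + twice (R.z ⬝ᵥ P.x) + 2
    rw [key _ _ h]; ring
  · exact congrFun (add_comm P.x R.x) _
  · exact congrFun (add_comm P.z R.z) _

theorem neg_one_pow_val_add (a b : ZMod 2) :
    (-1 : ℂ) ^ (a + b).val = (-1) ^ a.val * (-1) ^ b.val := by
  rw [ZMod.val_add, ← pow_add, ← neg_one_pow_eq_pow_mod_two]

theorem I_pow_val_add (a b : ZMod 4) :
    Complex.I ^ (a + b).val = Complex.I ^ a.val * Complex.I ^ b.val := by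
  rw [ZMod.val_add, ← pow_add, ← Nat.mod_add_div (a.val + b.val) 4, pow_add, pow_mul]
  simp

theorem I_pow_val_twice (b : ZMod 2) : Complex.I ^ (twice b).val = (-1) ^ b.val := by
  have h : ∀ b : ZMod 2, (twice b).val = 2 * b.val := by decide
  rw [h, pow_mul, Complex.I_sq]

theorem operator_apply (P : PauliGroup n) (ψ : QubitSpace n) (y : Fin n → ZMod 2) :
    P.operator ψ y =
      Complex.I ^ P.phase.val * (-1 : ℂ) ^ (P.z ⬝ᵥ (y - P.x)).val * ψ (y - P.x) := rfl

theorem operator_mul (P R : PauliGroup n) (ψ : QubitSpace n) :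
    (P * R).operator ψ = P.operator (R.operator ψ) := by
  funext y
  have h1 : y - (P.x + R.x) = y - P.x - R.x := by abel
  have h2 : P.z ⬝ᵥ (y - P.x) = P.z ⬝ᵥ (y - P.x - R.x) + P.z ⬝ᵥ R.x := by
    rw [← dotProduct_add, sub_add_cancel]
  have h3 : ((-1 : ℂ) ^ (P.z ⬝ᵥ R.x).val) * (-1) ^ (P.z ⬝ᵥ R.x).val = 1 := by
    rw [← mul_pow]; simp
  simp only [operator_apply, mul_phase, mul_x, mul_z, h1, h2, add_dotProduct,
    neg_one_pow_val_add, I_pow_val_add, I_pow_val_twice]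
  ring

theorem operator_neg (P : PauliGroup n) (ψ : QubitSpace n) :
    (-P).operator ψ = -P.operator ψ := by
  funext y
  change Complex.I ^ (P.phase + 2).val * (-1 : ℂ) ^ (P.z ⬝ᵥ (y - P.x)).val * ψ (y - P.x) =
    -(Complex.I ^ P.phase.val * (-1 : ℂ) ^ (P.z ⬝ᵥ (y - P.x)).val * ψ (y - P.x))
  have h2 : Complex.I ^ (2 : ZMod 4).val = -1 := Complex.I_sq
  rw [I_pow_val_add, h2]
  ring

theorem operator_one (ψ : QubitSpace n) : (1 : PauliGroup n).operator ψ = ψ := by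
  funext y
  simp [operator_apply]

theorem operator_ne_zero (P : PauliGroup n) {ψ : QubitSpace n} (h : ψ ≠ 0) :
    P.operator ψ ≠ 0 := by
  intro h0
  apply h
  rw [← operator_one ψ, ← inv_mul_cancel P, operator_mul, h0, map_zero]

/-- Every sum of Pauli operators up to phase is realized by a product of the operators
themselves. -/
theorem exists_mem_closure_of_mem_span {A : Set (PauliGroup n)} {w : PauliVec n}
    (hw : w ∈ Submodule.span (ZMod 2) (vec '' A)) : ∃ P ∈ Subgroup.closure A, P.vec = w := by
  induction hw using Submodule.span_induction with
  | mem x hx =>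
    obtain ⟨P, hP, rfl⟩ := hx
    exact ⟨P, Subgroup.subset_closure hP, rfl⟩
  | zero => exact ⟨1, one_mem _, rfl⟩
  | add x y _ _ hx hy =>
    obtain ⟨P, hP, rfl⟩ := hx
    obtain ⟨R, hR, rfl⟩ := hy
    exact ⟨P * R, mul_mem hP hR, rfl⟩
  | smul c x _ hx =>
    obtain ⟨P, hP, rfl⟩ := hx
    have hc : c = 0 ∨ c = 1 := by revert c; decide
    rcases hc with rfl | rfl
    · exact ⟨1, one_mem _, by simp⟩
    · exact ⟨P, hP, by simp⟩

end PauliGroup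

namespace StabilizerCode

variable {n k : ℕ} (C : StabilizerCode n k)

/-- The stabilizer group up to phase. -/
noncomputable def stabSpace : Submodule (ZMod 2) (PauliVec n) :=
  Submodule.span (ZMod 2) (Set.range fun i => (C.gen i).vec)

theorem gen_mem (i : Fin (n - k)) : C.gen i ∈ C.stab := by
  rw [← C.closure_gen]
  exact Subgroup.subset_closure ⟨i, rfl⟩

theorem vec_mem_stabSpace {P : PauliGroup n} (hP : P ∈ C.stab) : P.vec ∈ C.stabSpace := by
  rw [← C.closure_gen] at hP
  induction hP using Subgroup.closure_induction with
  | mem x hx =>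
    obtain ⟨i, rfl⟩ := hx
    exact Submodule.subset_span ⟨i, rfl⟩
  | one => exact Submodule.zero_mem _
  | mul x y _ _ hx hy => exact Submodule.add_mem _ hx hy
  | inv x _ hx => exact Submodule.neg_mem _ hx

theorem exists_mem_stab {w : PauliVec n} (hw : w ∈ C.stabSpace) : ∃ P ∈ C.stab, P.vec = w := by
  rw [← C.closure_gen]
  apply PauliGroup.exists_mem_closure_of_mem_span
  rwa [← Set.range_comp]

theorem stabSpace_le_orthogonal :
    C.stabSpace ≤ (symplecticForm n).orthogonal C.stabSpace := by
  intro v hv w hw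
  obtain ⟨P, hP, rfl⟩ := C.exists_mem_stab hv
  obtain ⟨R, hR, rfl⟩ := C.exists_mem_stab hw
  exact (PauliGroup.commute_iff _ _).1 (C.comm R hR P hP)

/-- As `-1` is not a stabilizer, neither is any other nontrivial scalar. -/
theorem eq_one_of_vec_eq_zero {P : PauliGroup n} (hP : P ∈ C.stab) (h : P.vec = 0) : P = 1 := by
  have hx : P.x = 0 := congrArg Prod.fst h
  have hz : P.z = 0 := congrArg Prod.snd h
  have h2 : P.phase ≠ 2 := by
    intro h2
    apply C.neg_one_notMem
    convert hP using 1
    ext j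
    · rw [h2]; rfl
    · rw [hx]; rfl
    · rw [hz]; rfl
  have hsq : P.phase + P.phase ≠ 2 := by
    intro h2
    apply C.neg_one_notMem
    convert mul_mem hP hP using 1
    ext j
    · rw [PauliGroup.mul_phase, h2, hz, zero_dotProduct, PauliGroup.twice_zero]; rfl
    · rw [PauliGroup.mul_x, hx, add_zero]; rfl
    · rw [PauliGroup.mul_z, hz, add_zero]; rfl
  have key : ∀ a : ZMod 4, a ≠ 2 → a + a ≠ 2 → a = 0 := by decide
  ext j
  · exact key _ h2 hsq
  · rw [hx]; rfl
  · rw [hz]; rfl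

theorem linearIndependent_vec_gen :
    LinearIndependent (ZMod 2) fun i => (C.gen i).vec := by
  rw [linearIndependent_iff_notMem_span]
  intro i hi
  have himg : (fun j => (C.gen j).vec) '' (Set.univ \ {i}) =
      PauliGroup.vec '' (C.gen '' {j | j ≠ i}) := by
    rw [Set.image_image]
    congr 1
    ext j
    simp
  rw [himg] at hi
  obtain ⟨P, hP, hPi⟩ := PauliGroup.exists_mem_closure_of_mem_span hi
  have hPs : P ∈ C.stab := by
    rw [← C.closure_gen]
    exact Subgroup.closure_mono (Set.image_subset_range _ _) hP
  have h1 := C.eq_one_of_vec_eq_zero (mul_mem (C.gen_mem i) (inv_mem hPs)) (by simp [hPi])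
  rw [mul_inv_eq_one] at h1
  exact C.gen_indep i (h1 ▸ hP)

theorem finrank_stabSpace : Module.finrank (ZMod 2) C.stabSpace = n - k := by
  rw [stabSpace, finrank_span_eq_card C.linearIndependent_vec_gen, Fintype.card_fin]

/-- A Pauli operator that commutes with the stabilizers without being one, up to phase, is a
logical error. If it fixed all codewords up to scalars, then a logical operator `F`
anticommuting with it would carry a codeword `ψ` to a codeword with the opposite eigenvalue, and
`ψ + F ψ` would not be an eigenvector. That a nonzero codeword exists is part of the hypothesis. -/
theorem isLogicalError_of_notMem {E : PauliGroup n}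
    (hE : E.vec ∈ (symplecticForm n).orthogonal C.stabSpace) (hE' : E.vec ∉ C.stabSpace)
    (hne : ∃ ψ ∈ C.codeSpace, ψ ≠ 0) : C.IsLogicalError E := by
  have hpres : ∀ F : PauliGroup n, F.vec ∈ (symplecticForm n).orthogonal C.stabSpace →
      ∀ ψ ∈ C.codeSpace, F.operator ψ ∈ C.codeSpace := by
    intro F hF ψ hψ P hP
    have hc : P * F = F * P := (PauliGroup.commute_iff _ _).2 (hF _ (C.vec_mem_stabSpace hP))
    rw [← PauliGroup.operator_mul, hc, PauliGroup.operator_mul, hψ P hP]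
  obtain ⟨f, hf, hfE⟩ : ∃ f ∈ (symplecticForm n).orthogonal C.stabSpace,
      symplecticForm n f E.vec ≠ 0 := by
    by_contra! h
    apply hE'
    rw [← PauliVec.orthogonal_orthogonal C.stabSpace]
    exact h
  let F : PauliGroup n := ⟨0, f.1, f.2⟩
  obtain ⟨ψ, hψ, hψ0⟩ := hne
  have hFψ := hpres F hf ψ hψ
  have hFψ0 := F.operator_ne_zero hψ0
  by_contra hlog
  have hscal : ∀ φ ∈ C.codeSpace, ∃ c : ℂ, E.operator φ = c • φ := by
    intro φ hφ
    by_contra! h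
    exact hlog ⟨φ, hφ, hpres E hE φ hφ, h⟩
  obtain ⟨c, hc⟩ := hscal ψ hψ
  have hc0 : c ≠ 0 := by
    rintro rfl
    exact E.operator_ne_zero hψ0 (by simpa using hc)
  have hEF : E.operator (F.operator ψ) = -(c • F.operator ψ) := by
    rw [← PauliGroup.operator_mul, PauliGroup.mul_eq_neg_mul E F
      (by rw [PauliVec.symplecticForm_comm]; exact hfE), PauliGroup.operator_neg,
      PauliGroup.operator_mul, hc, map_smul]
  obtain ⟨b, hb⟩ := hscal _ (C.codeSpace.add_mem hψ hFψ)
  rw [map_add, hc, hEF, smul_add] at hb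
  -- `(c - b) ψ = (c + b) F ψ`; applying `E` gives `c (c - b) ψ = -c (c + b) F ψ`.
  have h1 : (c - b) • ψ = (c + b) • F.operator ψ := by
    rw [sub_smul, add_smul]
    linear_combination (exp := 1) hb
  have h2 := congrArg E.operator h1
  rw [map_smul, map_smul, hc, hEF] at h2
  have h3 : (2 * c * (c - b)) • ψ = 0 := by
    have : (2 * c * (c - b)) • ψ = c • ((c - b) • ψ) + (c - b) • c • ψ := by
      simp only [smul_smul, ← add_smul]; congr 1; ring
    rw [this, h1, h2, smul_neg, smul_comm c (c + b), add_neg_cancel]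
  have h4 : c = b := by
    rcases smul_eq_zero.1 h3 with h | h
    · have : c - b = 0 := by simpa [hc0] using h
      exact sub_eq_zero.1 this
    · exact absurd h hψ0
  rw [← h4, sub_self, zero_smul] at h1
  rcases smul_eq_zero.1 h1.symm with h | h
  · exact hc0 (by linear_combination h / 2)
  · exact hFψ0 h

theorem HasDistance.correctable {C : StabilizerCode n k} {d : ℕ} (h : C.HasDistance d)
    {M : Finset (Fin n)} (hM : M.card < d) : PauliVec.Correctable C.stabSpace M := by
  obtain ⟨⟨E₀, ⟨ψ, hψ, _, hne⟩, _⟩, hmin⟩ := h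
  rintro v ⟨hv1, hv2⟩
  by_contra hv
  have hψ0 : ψ ≠ 0 := by
    rintro rfl
    exact hne 0 (by simp)
  have hlog : C.IsLogicalError ⟨0, v.1, v.2⟩ := C.isLogicalError_of_notMem hv2 hv ⟨ψ, hψ, hψ0⟩
  have h1 := hmin ⟨_, hlog, rfl⟩
  have h2 : v.supp.card ≤ M.card := Finset.card_le_card (PauliVec.mem_supportedOn_iff_supp.1 hv1)
  have h3 : (⟨0, v.1, v.2⟩ : PauliGroup n).weight = v.supp.card := rfl
  omega

theorem HasDistance.le {C : StabilizerCode n k} {d : ℕ} (h : C.HasDistance d) : d ≤ n := by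
  obtain ⟨⟨E, _, rfl⟩, _⟩ := h
  exact (Finset.card_le_univ _).trans_eq (Fintype.card_fin n)

end StabilizerCode

/-! ### Layouts on a grid of square cells -/

/-- Qubits placed on the cells of the square grid `ℤ × ℤ`, at most `m` per cell, together with a
set of bad qubits such that a generator containing a good qubit `p` stays within the cells
next to that of `p` (including diagonally). -/
structure CellLayout {n k : ℕ} (C : StabilizerCode n k) (m : ℕ) where
  cell : Fin n → ℤ × ℤ
  bad : Finset (Fin n)
  adj : ∀ i, ∀ p ∈ (C.gen i).support, ∀ q ∈ (C.gen i).support, ¬ (p ∈ bad ∧ q ∈ bad) →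
    (cell p).1 ≤ (cell q).1 + 1 ∧ (cell p).2 ≤ (cell q).2 + 1
  card_cell : ∀ c, (Finset.univ.filter fun p => cell p = c).card ≤ m

theorem StabilizerCode.two_mul_le_of_finrank {n k : ℕ} (C : StabilizerCode n k)
    (M : Finset (Fin n)) {a b : ℕ}
    (ha : Module.finrank (ZMod 2) (PauliVec.logicalSpan C.stabSpace M) ≤ (n - k) + a)
    (hb : Module.finrank (ZMod 2) (PauliVec.logicalSpan C.stabSpace Mᶜ) ≤ (n - k) + b) :
    2 * k ≤ a + b := by
  have := PauliVec.finrank_logicalSpan_add_compl C.stabSpace_le_orthogonal M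
  have := C.k_le
  omega

theorem StabilizerCode.finrank_logicalSpan_of_correctable {n k : ℕ} (C : StabilizerCode n k)
    {M : Finset (Fin n)} (hM : PauliVec.Correctable C.stabSpace M) :
    Module.finrank (ZMod 2) (PauliVec.logicalSpan C.stabSpace M) = n - k := by
  rw [hM.logicalSpan_eq, C.finrank_stabSpace]

namespace CellLayout

open PauliVec

variable {n k m d s : ℕ} {C : StabilizerCode n k} (l : CellLayout C m)

/-- The qubits in the `w × h` rectangle of cells with lower left corner `(α, γ)`. -/
def rect (α γ : ℤ) (w h : ℕ) : Finset (Fin n) :=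
  Finset.univ.filter fun p =>
    (α ≤ (l.cell p).1 ∧ (l.cell p).1 < α + w) ∧ (γ ≤ (l.cell p).2 ∧ (l.cell p).2 < γ + h)

theorem mem_rect {α γ : ℤ} {w h : ℕ} {p : Fin n} : p ∈ l.rect α γ w h ↔
    (α ≤ (l.cell p).1 ∧ (l.cell p).1 < α + w) ∧
      (γ ≤ (l.cell p).2 ∧ (l.cell p).2 < γ + h) := by
  simp [rect]

theorem card_le_of_cells {M : Finset (Fin n)} (Z : Finset (ℤ × ℤ)) (h : ∀ p ∈ M, l.cell p ∈ Z) :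
    M.card ≤ m * Z.card :=
  Finset.card_le_mul_card_image_of_maps_to h m fun c _ =>
    (Finset.card_le_card (Finset.filter_subset_filter _ (Finset.subset_univ M))).trans
      (l.card_cell c)

theorem correctable_union {U T : Finset (Fin n)} (hU : Correctable C.stabSpace U)
    (hT : Correctable C.stabSpace T)
    (h : ∀ i, ¬ Disjoint (C.gen i).support U → (C.gen i).support ⊆ U ∪ T) :
    Correctable C.stabSpace (U ∪ T) :=
  Correctable.union_of_generators C.stabSpace_le_orthogonal hU hT h

/-- The good part of a rectangle is correctable if its perimeter and the bad qubits in it are few.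
The rectangle is built up column by column: the part already built is correctable, and so is, by
its size, the set of the qubits that it interacts with. -/
theorem correctable_rect (hd : C.HasDistance d) {N h : ℕ} (hN : h + 1 ≤ N)
    (hs : 4 * (N + 1) * m ≤ s) (hsd : 2 * s < d) (α γ : ℤ) (w : ℕ) (hw : w + 1 ≤ N)
    (hbad : (l.rect α γ w h ∩ l.bad).card ≤ s) :
    Correctable C.stabSpace (l.rect α γ w h \ l.bad) := by
  induction w with
  | zero =>
    apply hd.correctable
    have : l.rect α γ 0 h = ∅ := by
      ext p
      simp only [mem_rect, Finset.notMem_empty, iff_false]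
      push_cast
      omega
    rw [this]
    simp
    omega
  | succ w ih =>
    have hsub : l.rect α γ w h ⊆ l.rect α γ (w + 1) h := by
      intro p hp
      rw [mem_rect] at hp ⊢
      push_cast
      omega
    have hbad' : (l.rect α γ w h ∩ l.bad).card ≤ s :=
      (Finset.card_le_card (Finset.inter_subset_inter_right hsub)).trans hbad
    let Z : Finset (ℤ × ℤ) := (({α - 1, α + w} : Finset ℤ) ×ˢ Finset.Ico γ (γ + h)) ∪
      (Finset.Ico (α - 1) (α + w + 1) ×ˢ ({γ - 1, γ + h} : Finset ℤ))
    have hZ : Z.card ≤ 4 * (N + 1) := by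
      have h2 : ∀ x y : ℤ, ({x, y} : Finset ℤ).card ≤ 2 := fun x y => Finset.card_le_two
      have e1 := Nat.mul_le_mul_right h (h2 (α - 1) (α + w))
      have e2 := Nat.mul_le_mul_left (w + 2) (h2 (γ - 1) (γ + h))
      refine (Finset.card_union_le _ _).trans ?_
      rw [Finset.card_product, Finset.card_product, Int.card_Ico, Int.card_Ico,
        show (γ + h - γ).toNat = h by omega, show (α + w + 1 - (α - 1)).toNat = w + 2 by omega]
      omega
    let P : Finset (Fin n) := Finset.univ.filter fun p => l.cell p ∈ Z
    have hP : P.card ≤ s := by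
      refine (l.card_le_of_cells Z fun p hp => (Finset.mem_filter.1 hp).2).trans ?_
      rw [mul_comm]
      exact (Nat.mul_le_mul_right m hZ).trans hs
    have hT : Correctable C.stabSpace (P ∪ (l.rect α γ w h ∩ l.bad)) := by
      apply hd.correctable
      have := Finset.card_union_le P (l.rect α γ w h ∩ l.bad)
      omega
    have memP : ∀ p, p ∈ P ↔ (((l.cell p).1 = α - 1 ∨ (l.cell p).1 = α + w) ∧
        (γ ≤ (l.cell p).2 ∧ (l.cell p).2 < γ + h)) ∨
        ((α - 1 ≤ (l.cell p).1 ∧ (l.cell p).1 < α + w + 1) ∧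
          ((l.cell p).2 = γ - 1 ∨ (l.cell p).2 = γ + h)) := by
      intro p
      simp [P, Z, Finset.mem_product]
    refine (correctable_union (ih (by omega) hbad') hT ?_).mono ?_
    · intro i hi q hq
      obtain ⟨p, hp, hpU⟩ := Finset.not_disjoint_iff.1 hi
      rw [Finset.mem_sdiff, mem_rect] at hpU
      have a1 := l.adj i p hp q hq fun h => hpU.2 h.1
      have a2 := l.adj i q hq p hp fun h => hpU.2 h.2
      simp only [Finset.mem_union, Finset.mem_sdiff, Finset.mem_inter, mem_rect, memP]
      by_cases hqb : q ∈ l.bad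
      · simp only [hqb, not_true_eq_false, and_false, and_true, false_or]
        omega
      · simp only [hqb, not_false_eq_true, and_true, and_false, or_false]
        omega
    · intro p hp
      rw [Finset.mem_sdiff, mem_rect] at hp
      simp only [Finset.mem_union, Finset.mem_sdiff, Finset.mem_inter, mem_rect, memP]
      have := hp.2
      push_cast at hp
      simp only [this, not_false_eq_true, and_true, and_false, or_false]
      omega

/-- Two good regions are correctable together if an empty column separates them. -/
theorem correctable_union_of_column {U T : Finset (Fin n)} (hU : Correctable C.stabSpace U)
    (hT : Correctable C.stabSpace T) (hUg : Disjoint U l.bad) (hTg : Disjoint T l.bad)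
    (x : ℤ) (hUx : ∀ p ∈ U, (l.cell p).1 < x) (hTx : ∀ p ∈ T, x < (l.cell p).1) :
    Correctable C.stabSpace (U ∪ T) := by
  have hgood : ∀ p ∈ U ∪ T, p ∉ l.bad := fun p hp => (Finset.mem_union.1 hp).elim
    (fun h => Finset.disjoint_left.1 hUg h) (fun h => Finset.disjoint_left.1 hTg h)
  refine Correctable.of_fibers (fun p => decide ((l.cell p).1 < x)) ?_ ?_
  · rintro (_ | _)
    · refine hT.mono fun p hp => ?_
      simp only [Finset.mem_filter, Finset.mem_union, decide_eq_false_iff_not] at hp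
      exact hp.1.resolve_left fun h => hp.2 (hUx p h)
    · refine hU.mono fun p hp => ?_
      simp only [Finset.mem_filter, Finset.mem_union, decide_eq_true_eq] at hp
      exact hp.1.resolve_right fun h => lt_asymm hp.2 (hTx p h)
  · intro i p hp q hq hpi hqi
    have a1 := l.adj i p hpi q hqi fun h => hgood p hp h.1
    have a2 := l.adj i q hqi p hpi fun h => hgood p hp h.2
    have b : ∀ p ∈ U ∪ T, (l.cell p).1 ≠ x := fun p hp => (Finset.mem_union.1 hp).elim
      (fun h => (hUx p h).ne) (fun h => (hTx p h).ne')
    have := b p hp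
    have := b q hq
    simp only [decide_eq_decide]
    omega

/-- Deleting at most as many good qubits as there are bad ones makes the good part of a rectangle
correctable, however many bad qubits there are: the rectangle is cut into slabs with few bad
qubits, and one column, of size at most `s`, is deleted for every `s` bad qubits. -/
theorem exists_correctable_subset_rect (hd : C.HasDistance d) {N h : ℕ} (hN : h + 1 ≤ N)
    (hs : 4 * (N + 1) * m ≤ s) (hsd : 2 * s < d) (γ : ℤ) (w : ℕ) (hw : w + 1 ≤ N) (α : ℤ) :
    ∃ M ⊆ l.rect α γ w h \ l.bad, Correctable C.stabSpace M ∧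
      ((l.rect α γ w h \ l.bad) \ M).card ≤ (l.rect α γ w h ∩ l.bad).card := by
  induction w using Nat.strong_induction_on generalizing α with
  | _ w ih =>
    by_cases hb : (l.rect α γ w h ∩ l.bad).card ≤ s
    · exact ⟨_, subset_rfl, l.correctable_rect hd hN hs hsd α γ w hw hb, by simp⟩
    -- The first `j + 1` columns are the shortest initial slab with more than `s` bad qubits.
    have hex : ∃ j, s < (l.rect α γ j h ∩ l.bad).card := ⟨w, not_le.1 hb⟩
    obtain ⟨j, hj1, hj2⟩ : ∃ j, s < (l.rect α γ (j + 1) h ∩ l.bad).card ∧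
        (l.rect α γ j h ∩ l.bad).card ≤ s ∧ j + 1 ≤ w := by
      classical
      have h0 : Nat.find hex ≠ 0 := by
        intro h0
        have := Nat.find_spec hex
        rw [h0] at this
        have he : l.rect α γ 0 h = ∅ := by
          ext p
          simp only [mem_rect, Finset.notMem_empty, iff_false]
          push_cast
          omega
        rw [he] at this
        simp at this
      obtain ⟨j, hj⟩ := Nat.exists_eq_succ_of_ne_zero h0
      refine ⟨j, ?_, ?_, ?_⟩
      · have := Nat.find_spec hex
        rwa [hj] at this
      · exact not_lt.1 (Nat.find_min hex (by omega))
      · have := Nat.find_min' hex (not_le.1 hb)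
        omega
    obtain ⟨hj2, hjw⟩ := hj2
    have hL := l.correctable_rect hd hN hs hsd α γ j (by omega) hj2
    obtain ⟨M, hMsub, hM, hMcard⟩ := ih (w - (j + 1)) (by omega) (by omega) (α + j + 1)
    refine ⟨(l.rect α γ j h \ l.bad) ∪ M, ?_, ?_, ?_⟩
    · intro p hp
      rcases Finset.mem_union.1 hp with hp | hp
      · rw [Finset.mem_sdiff, mem_rect] at hp ⊢
        exact ⟨by omega, hp.2⟩
      · have := hMsub hp
        rw [Finset.mem_sdiff, mem_rect] at this ⊢
        exact ⟨by omega, this.2⟩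
    · refine l.correctable_union_of_column hL hM Finset.sdiff_disjoint
        (Finset.disjoint_of_subset_left hMsub Finset.sdiff_disjoint) (α + j) ?_ ?_
      · intro p hp
        rw [Finset.mem_sdiff, mem_rect] at hp
        omega
      · intro p hp
        have := hMsub hp
        rw [Finset.mem_sdiff, mem_rect] at this
        omega
    · set R := l.rect (α + j + 1) γ (w - (j + 1)) h
      have hcol : (l.rect (α + j) γ 1 h).card ≤ s := by
        refine (l.card_le_of_cells ({α + (j : ℤ)} ×ˢ Finset.Ico γ (γ + h)) fun p hp => ?_).trans ?_
        · rw [mem_rect] at hp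
          push_cast at hp
          simp only [Finset.mem_product, Finset.mem_singleton, Finset.mem_Ico]
          omega
        · rw [Finset.card_product, Int.card_Ico, Finset.card_singleton, one_mul,
            show (γ + h - γ).toNat = h by omega, mul_comm]
          exact (Nat.mul_le_mul_right m (by omega)).trans hs
      have h1 : (l.rect α γ w h \ l.bad) \ ((l.rect α γ j h \ l.bad) ∪ M) ⊆
          l.rect (α + j) γ 1 h ∪ ((R \ l.bad) \ M) := by
        intro p hp
        simp only [R, Finset.mem_sdiff, Finset.mem_union, mem_rect, not_or] at hp ⊢
        obtain ⟨⟨hp1, hp2⟩, hp3, hp4⟩ := hp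
        simp only [hp2, hp4, not_false_eq_true, and_true] at hp3 ⊢
        push_cast
        omega
      have h2 : (l.rect α γ (j + 1) h ∩ l.bad) ∪ (R ∩ l.bad) ⊆ l.rect α γ w h ∩ l.bad := by
        intro p hp
        simp only [R, Finset.mem_inter, Finset.mem_union, mem_rect] at hp ⊢
        rcases hp with hp | hp
        · exact ⟨by push_cast at hp; omega, hp.2⟩
        · exact ⟨by omega, hp.2⟩
      have h3 : Disjoint (l.rect α γ (j + 1) h ∩ l.bad) (R ∩ l.bad) := by
        rw [Finset.disjoint_left]
        intro p hp hp'
        simp only [R, Finset.mem_inter, mem_rect] at hp hp'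
        push_cast at hp
        omega
      have c1 := Finset.card_le_card h1
      have c2 := Finset.card_le_card h2
      rw [Finset.card_union_of_disjoint h3] at c2
      have c3 := Finset.card_union_le (l.rect (α + j) γ 1 h) ((R \ l.bad) \ M)
      omega

end CellLayout

/-! ### Tiling the plane by boxes, strips and crossings -/

theorem Int.ediv_eq_ediv_of_adj {N u v : ℤ} (hN : 0 < N) (hu : ¬ N ∣ u) (hv : ¬ N ∣ v)
    (h1 : u ≤ v + 1) (h2 : v ≤ u + 1) : u / N = v / N := by
  have key : ∀ u v : ℤ, ¬ N ∣ v → v ≤ u + 1 → v / N ≤ u / N := by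
    intro u v hv h
    by_contra! hlt
    have e1 := Int.mul_ediv_add_emod u N
    have e2 := Int.mul_ediv_add_emod v N
    have l1 := Int.emod_lt_of_pos u hN
    have l2 := Int.emod_nonneg v hN.ne'
    have l3 : v % N ≠ 0 := fun h => hv (Int.dvd_of_emod_eq_zero h)
    have l4 : N * (u / N + 1) ≤ N * (v / N) := mul_le_mul_of_nonneg_left hlt hN.le
    rw [mul_add, mul_one] at l4
    omega
  exact le_antisymm (key v u hu h1) (key u v hv h2)

theorem Int.mem_box_iff {N : ℕ} (hN : 0 < N) (a i x : ℤ) :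
    (a + N * i + 1 ≤ x ∧ x < a + N * i + 1 + (N - 1 : ℕ)) ↔
      ¬ (N : ℤ) ∣ x - a ∧ (x - a) / N = i := by
  have hN' : (0 : ℤ) < N := by exact_mod_cast hN
  have e1 := Int.mul_ediv_add_emod (x - a) N
  have l1 := Int.emod_lt_of_pos (x - a) hN'
  have l2 := Int.emod_nonneg (x - a) hN'.ne'
  rw [Int.dvd_iff_emod_eq_zero]
  constructor
  · rintro ⟨h1, h2⟩
    have hi : (x - a) / N = i := by
      rcases lt_trichotomy ((x - a) / N) i with h | h | h
      · have l4 : (N : ℤ) * ((x - a) / N + 1) ≤ N * i := mul_le_mul_of_nonneg_left h hN'.le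
        rw [mul_add, mul_one] at l4
        omega
      · exact h
      · have l4 : (N : ℤ) * (i + 1) ≤ N * ((x - a) / N) := mul_le_mul_of_nonneg_left h hN'.le
        rw [mul_add, mul_one] at l4
        omega
    refine ⟨?_, hi⟩
    rw [hi] at e1
    omega
  · rintro ⟨h1, rfl⟩
    omega

/-- A line of the grid with spacing `N` passes through a given point for at most one shift. -/
theorem card_filter_dvd_sub_le_one (N : ℕ) (x : ℤ) :
    ((Finset.range N).filter fun a : ℕ => (N : ℤ) ∣ x - a).card ≤ 1 := by
  rw [Finset.card_le_one]
  intro a ha b hb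
  simp only [Finset.mem_filter, Finset.mem_range] at ha hb
  have h : (N : ℤ) ∣ (a : ℤ) - b := by
    have := dvd_sub hb.2 ha.2
    rwa [show x - (b : ℤ) - (x - a) = a - b by ring] at this
  have h2 := Int.eq_zero_of_abs_lt_dvd h (by rw [abs_lt]; omega)
  omega

/-- The integers next to or on the grid `N ℤ`. -/
def NearGrid (N : ℕ) (u : ℤ) : Prop := (N : ℤ) ∣ u - 1 ∨ (N : ℤ) ∣ u ∨ (N : ℤ) ∣ u + 1

instance (N : ℕ) : DecidablePred (NearGrid N) := fun _ => inferInstanceAs (Decidable (_ ∨ _))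

theorem nearGrid_of_adj {N : ℕ} {u v : ℤ} (hu : (N : ℤ) ∣ u) (h1 : u ≤ v + 1) (h2 : v ≤ u + 1) :
    NearGrid N v := by
  have h3 : u = v - 1 ∨ u = v ∨ u = v + 1 := by omega
  rcases h3 with rfl | rfl | rfl
  · exact Or.inl hu
  · exact Or.inr (Or.inl hu)
  · exact Or.inr (Or.inr hu)

theorem card_filter_nearGrid_le (N : ℕ) (x : ℤ) :
    ((Finset.range N).filter fun a : ℕ => NearGrid N (x - a)).card ≤ 3 := by
  have h1 := card_filter_dvd_sub_le_one N (x - 1)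
  have h2 := card_filter_dvd_sub_le_one N x
  have h3 := card_filter_dvd_sub_le_one N (x + 1)
  have hsub : ((Finset.range N).filter fun a : ℕ => NearGrid N (x - a)) ⊆
      ((Finset.range N).filter fun a : ℕ => (N : ℤ) ∣ x - 1 - a) ∪
        (((Finset.range N).filter fun a : ℕ => (N : ℤ) ∣ x - a) ∪
          ((Finset.range N).filter fun a : ℕ => (N : ℤ) ∣ x + 1 - a)) := by
    intro a ha
    obtain ⟨h0, h⟩ := Finset.mem_filter.1 ha
    simp only [Finset.mem_filter, Finset.mem_union]
    rw [show x - 1 - (a : ℤ) = x - a - 1 by ring, show x + 1 - (a : ℤ) = x - a + 1 by ring]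
    exact h.imp (⟨h0, ·⟩) (Or.imp (⟨h0, ·⟩) (⟨h0, ·⟩))
  have c1 := Finset.card_le_card hsub
  have c2 := Finset.card_union_le ((Finset.range N).filter fun a : ℕ => (N : ℤ) ∣ x - 1 - a)
    (((Finset.range N).filter fun a : ℕ => (N : ℤ) ∣ x - a) ∪
      ((Finset.range N).filter fun a : ℕ => (N : ℤ) ∣ x + 1 - a))
  have c3 := Finset.card_union_le ((Finset.range N).filter fun a : ℕ => (N : ℤ) ∣ x - a)
    ((Finset.range N).filter fun a : ℕ => (N : ℤ) ∣ x + 1 - a)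
  omega

theorem Finset.exists_card_mul_le_sum {ι : Type*} {t : Finset ι} (ht : t.Nonempty) (f : ι → ℕ) :
    ∃ i ∈ t, t.card * f i ≤ ∑ j ∈ t, f j := by
  obtain ⟨i, hi, hmin⟩ := t.exists_min_image f ht
  exact ⟨i, hi, by simpa using t.card_nsmul_le_sum f (f i) hmin⟩

/-- Double counting: if each element of `M` has property `P c` for at most `b` of the `c ∈ t`,
then the number of elements with property `P c`, summed over `c ∈ t`, is at most `b * M.card`. -/
theorem Finset.sum_card_filter_le {ι α : Type*} (t : Finset ι) (M : Finset α) (P : ι → α → Prop)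
    [∀ c, DecidablePred (P c)] (b : ℕ) (h : ∀ p ∈ M, (t.filter fun c => P c p).card ≤ b) :
    ∑ c ∈ t, (M.filter (P c)).card ≤ b * M.card := by
  simp only [Finset.card_filter]
  rw [Finset.sum_comm, mul_comm, ← smul_eq_mul, ← Finset.sum_const]
  refine Finset.sum_le_sum fun p hp => ?_
  rw [← Finset.card_filter]
  exact h p hp

namespace CellLayout

open PauliVec

variable {n k m d s N : ℕ} {C : StabilizerCode n k} (l : CellLayout C m)

/-- The good qubits strictly inside the boxes cut out by the grid of spacing `N` through
`(a, b)`. -/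
def interior (N : ℕ) (a b : ℤ) : Finset (Fin n) :=
  Finset.univ.filter fun p =>
    p ∉ l.bad ∧ ¬ (N : ℤ) ∣ (l.cell p).1 - a ∧ ¬ (N : ℤ) ∣ (l.cell p).2 - b

/-- The qubits, good or bad, at the crossings of the grid lines. Each crossing consists of three
cells of the vertical line, so that the remaining parts of the lines do not touch. -/
def crossings (N : ℕ) (a b : ℤ) : Finset (Fin n) :=
  Finset.univ.filter fun p =>
    (N : ℤ) ∣ (l.cell p).1 - a ∧ NearGrid N ((l.cell p).2 - b)

/-- The good qubits on the grid lines away from the crossings. -/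
def strips (N : ℕ) (a b : ℤ) : Finset (Fin n) :=
  Finset.univ.filter fun p =>
    p ∉ l.bad ∧ ((N : ℤ) ∣ (l.cell p).1 - a ∨ (N : ℤ) ∣ (l.cell p).2 - b) ∧
      p ∉ l.crossings N a b

theorem mem_interior {a b : ℤ} {p : Fin n} : p ∈ l.interior N a b ↔
    p ∉ l.bad ∧ ¬ (N : ℤ) ∣ (l.cell p).1 - a ∧ ¬ (N : ℤ) ∣ (l.cell p).2 - b := by
  simp [interior]

theorem mem_crossings {a b : ℤ} {p : Fin n} : p ∈ l.crossings N a b ↔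
    (N : ℤ) ∣ (l.cell p).1 - a ∧ NearGrid N ((l.cell p).2 - b) := by
  simp [crossings]

theorem mem_strips {a b : ℤ} {p : Fin n} : p ∈ l.strips N a b ↔
    p ∉ l.bad ∧ ((N : ℤ) ∣ (l.cell p).1 - a ∨ (N : ℤ) ∣ (l.cell p).2 - b) ∧
      ¬ ((N : ℤ) ∣ (l.cell p).1 - a ∧ NearGrid N ((l.cell p).2 - b)) := by
  rw [← mem_crossings]
  simp [strips]

/-- The position of the box of the grid that contains `p`. -/
def boxIndex (N : ℕ) (a b : ℤ) (p : Fin n) : ℤ × ℤ :=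
  (((l.cell p).1 - a) / N, ((l.cell p).2 - b) / N)

/-- The qubits in the box with index `c`. -/
def box (N : ℕ) (a b : ℤ) (c : ℤ × ℤ) : Finset (Fin n) :=
  l.rect (a + N * c.1 + 1) (b + N * c.2 + 1) (N - 1) (N - 1)

theorem mem_box (hN : 0 < N) {a b : ℤ} {c : ℤ × ℤ} {p : Fin n} : p ∈ l.box N a b c ↔
    ¬ (N : ℤ) ∣ (l.cell p).1 - a ∧ ¬ (N : ℤ) ∣ (l.cell p).2 - b ∧ l.boxIndex N a b p = c := by
  rw [box, mem_rect, Int.mem_box_iff hN, Int.mem_box_iff hN, boxIndex, Prod.ext_iff]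
  tauto

theorem interior_filter (hN : 0 < N) (a b : ℤ) (c : ℤ × ℤ) :
    (l.interior N a b).filter (fun p => l.boxIndex N a b p = c) = l.box N a b c \ l.bad := by
  ext p
  rw [Finset.mem_filter, mem_interior, Finset.mem_sdiff, l.mem_box hN]
  tauto

/-- No generator meets the interiors of two boxes in good qubits. -/
theorem boxIndex_eq (hN : 0 < N) (a b : ℤ) (i) {p q : Fin n} (hp : p ∈ l.interior N a b)
    (hq : q ∈ l.interior N a b) (hpi : p ∈ (C.gen i).support) (hqi : q ∈ (C.gen i).support) :
    l.boxIndex N a b p = l.boxIndex N a b q := by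
  rw [mem_interior] at hp hq
  have a1 := l.adj i p hpi q hqi fun h => hp.1 h.1
  have a2 := l.adj i q hqi p hpi fun h => hp.1 h.2
  have hN' : (0 : ℤ) < N := by exact_mod_cast hN
  exact Prod.ext (Int.ediv_eq_ediv_of_adj hN' hp.2.1 hq.2.1 (by omega) (by omega))
    (Int.ediv_eq_ediv_of_adj hN' hp.2.2 hq.2.2 (by omega) (by omega))

theorem correctable_interior (hd : C.HasDistance d) (hN : 0 < N)
    (hs : 4 * (N + 1) * m ≤ s) (hsd : 2 * s < d) (hbad : l.bad.card ≤ s) (a b : ℤ) :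
    Correctable C.stabSpace (l.interior N a b) := by
  refine Correctable.of_fibers (l.boxIndex N a b) (fun c => ?_)
    fun i p hp q hq => l.boxIndex_eq hN a b i hp hq
  rw [l.interior_filter hN]
  exact l.correctable_rect hd (by omega) hs hsd _ _ _ (by omega)
    ((Finset.card_le_card Finset.inter_subset_right).trans hbad)

theorem exists_correctable_subset_interior (hd : C.HasDistance d) (hN : 0 < N)
    (hs : 4 * (N + 1) * m ≤ s) (hsd : 2 * s < d) (a b : ℤ) :
    ∃ M ⊆ l.interior N a b, Correctable C.stabSpace M ∧
      (l.interior N a b \ M).card ≤ l.bad.card := by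
  have hbox : ∀ c : ℤ × ℤ, ∃ M ⊆ l.box N a b c \ l.bad, Correctable C.stabSpace M ∧
      ((l.box N a b c \ l.bad) \ M).card ≤ (l.box N a b c ∩ l.bad).card := fun c =>
    l.exists_correctable_subset_rect hd (by omega) hs hsd _ _ (by omega) _
  choose M _ hM hMcard using hbox
  refine ⟨(l.interior N a b).filter fun p => p ∈ M (l.boxIndex N a b p),
    Finset.filter_subset _ _, ?_, ?_⟩
  · refine Correctable.of_fibers (l.boxIndex N a b) (fun c => (hM c).mono ?_)
      fun i p hp q hq => l.boxIndex_eq hN a b i (Finset.mem_filter.1 hp).1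
        (Finset.mem_filter.1 hq).1
    intro p hp
    simp only [Finset.mem_filter] at hp
    obtain ⟨⟨_, hp⟩, rfl⟩ := hp
    exact hp
  · have hmaps : ∀ t : Finset (Fin n), Set.MapsTo (l.boxIndex N a b) t
        (Finset.univ.image (l.boxIndex N a b)) := fun t p _ =>
      Finset.mem_coe.2 (Finset.mem_image_of_mem _ (Finset.mem_univ p))
    rw [Finset.card_eq_sum_card_fiberwise (hmaps _),
      Finset.card_eq_sum_card_fiberwise (hmaps l.bad)]
    refine Finset.sum_le_sum fun c _ => le_trans ?_ ((hMcard c).trans ?_)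
    · refine Finset.card_le_card fun p hp => ?_
      rw [← l.interior_filter hN]
      simp only [Finset.mem_filter, Finset.mem_sdiff, not_and] at hp ⊢
      obtain ⟨⟨hp1, hp2⟩, rfl⟩ := hp
      exact ⟨⟨hp1, rfl⟩, hp2 hp1⟩
    · refine Finset.card_le_card fun p hp => ?_
      rw [Finset.mem_inter, l.mem_box hN] at hp
      exact Finset.mem_filter.2 ⟨hp.2, hp.1.2.2⟩

theorem correctable_strips (hd : C.HasDistance d) (hN : 2 ≤ N)
    (hs : 4 * (N + 1) * m ≤ s) (hsd : 2 * s < d) (a b : ℤ) :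
    Correctable C.stabSpace (l.strips N a b) := by
  have hN' : (0 : ℤ) < N := by omega
  have hsmall : ∀ Z : Finset (ℤ × ℤ), Z.card = N → ∀ M : Finset (Fin n),
      (∀ p ∈ M, l.cell p ∈ Z) → Correctable C.stabSpace M := by
    intro Z hZ M hMZ
    apply hd.correctable
    have h1 := l.card_le_of_cells Z hMZ
    rw [hZ, mul_comm] at h1
    have h2 : N * m ≤ 4 * (N + 1) * m := Nat.mul_le_mul_right m (by omega)
    omega
  have hdiv : ∀ x a i : ℤ, (x - a) / N = i → a + N * i ≤ x ∧ x < a + N * i + N := by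
    rintro x a i rfl
    have e1 := Int.mul_ediv_add_emod (x - a) N
    have l1 := Int.emod_lt_of_pos (x - a) hN'
    have l2 := Int.emod_nonneg (x - a) hN'.ne'
    omega
  have hdvd : ∀ x a i : ℤ, (N : ℤ) ∣ x - a → (x - a) / N = i → x = a + N * i := by
    rintro x a i h rfl
    rw [Int.mul_ediv_cancel' h]
    ring
  -- A strip is given by its orientation and the index of the box at its upper right.
  refine Correctable.of_fibers
    (fun p => (decide ((N : ℤ) ∣ (l.cell p).1 - a), l.boxIndex N a b p)) ?_ ?_
  · rintro ⟨_ | _, c⟩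
    · refine hsmall (Finset.Ico (a + N * c.1) (a + N * c.1 + N) ×ˢ {b + N * c.2}) ?_ _ ?_
      · simp
      · intro p hp
        simp only [Finset.mem_filter, mem_strips, Prod.mk.injEq, decide_eq_false_iff_not] at hp
        obtain ⟨⟨_, h1, _⟩, h2, rfl⟩ := hp
        simp only [Finset.mem_product, Finset.mem_Ico, Finset.mem_singleton]
        exact ⟨hdiv _ _ _ rfl, hdvd _ _ _ (h1.resolve_left h2) rfl⟩
    · refine hsmall ({a + N * c.1} ×ˢ Finset.Ico (b + N * c.2) (b + N * c.2 + N)) ?_ _ ?_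
      · simp
      · intro p hp
        simp only [Finset.mem_filter, mem_strips, Prod.mk.injEq, decide_eq_true_eq] at hp
        obtain ⟨⟨_, h1, _⟩, h2, rfl⟩ := hp
        simp only [Finset.mem_product, Finset.mem_Ico, Finset.mem_singleton]
        exact ⟨hdvd _ _ _ h2 rfl, hdiv _ _ _ rfl⟩
  · intro i p hp q hq hpi hqi
    rw [mem_strips] at hp hq
    have a1 := l.adj i p hpi q hqi fun h => hp.1 h.1
    have a2 := l.adj i q hqi p hpi fun h => hp.1 h.2
    obtain ⟨-, hp1, hp2⟩ := hp
    obtain ⟨-, hq1, hq2⟩ := hq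
    have hsame : ∀ u v : ℤ, (N : ℤ) ∣ u → (N : ℤ) ∣ v → u ≤ v + 1 → v ≤ u + 1 → u = v := by
      intro u v hu hv h1 h2
      have := Int.eq_zero_of_abs_lt_dvd (dvd_sub hu hv) (by rw [abs_lt]; omega)
      omega
    have hself : ∀ u : ℤ, ¬ NearGrid N u → ¬ (N : ℤ) ∣ u := fun u h h' => h (Or.inr (Or.inl h'))
    by_cases hpX : (N : ℤ) ∣ (l.cell p).1 - a <;> by_cases hqX : (N : ℤ) ∣ (l.cell q).1 - a
    · have hpY := hself _ fun h => hp2 ⟨hpX, h⟩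
      have hqY := hself _ fun h => hq2 ⟨hqX, h⟩
      simp only [hpX, hqX, boxIndex]
      rw [hsame _ _ hpX hqX (by omega) (by omega),
        Int.ediv_eq_ediv_of_adj hN' hpY hqY (by omega) (by omega)]
    · exact absurd ⟨hpX, nearGrid_of_adj (hq1.resolve_left hqX) (by omega) (by omega)⟩ hp2
    · exact absurd ⟨hqX, nearGrid_of_adj (hp1.resolve_left hpX) (by omega) (by omega)⟩ hq2
    · simp only [hpX, hqX, boxIndex]
      rw [hsame _ _ (hp1.resolve_left hpX) (hq1.resolve_left hqX) (by omega) (by omega),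
        Int.ediv_eq_ediv_of_adj hN' hpX hqX (by omega) (by omega)]

end CellLayout

/-! ### Counting logical qubits -/

namespace CellLayout

open PauliVec

variable {n k m d s N : ℕ} {C : StabilizerCode n k} (l : CellLayout C m)

theorem finrank_logicalSpan_strips_union_le (hd : C.HasDistance d) (hN : 2 ≤ N)
    (hs : 4 * (N + 1) * m ≤ s) (hsd : 2 * s < d) (a b : ℤ) (T : Finset (Fin n)) :
    Module.finrank (ZMod 2) (logicalSpan C.stabSpace (l.strips N a b ∪ T)) ≤
      (n - k) + 2 * T.card := by
  have h := finrank_logicalSpan_union_le (S := C.stabSpace) (l.strips N a b) T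
  rwa [C.finrank_logicalSpan_of_correctable (l.correctable_strips hd hN hs hsd a b)] at h

theorem card_crossings_shifts_le (N : ℕ) (p : Fin n) :
    ((Finset.range N ×ˢ Finset.range N).filter fun c : ℕ × ℕ =>
      (N : ℤ) ∣ (l.cell p).1 - c.1 ∧ NearGrid N ((l.cell p).2 - c.2)).card ≤ 3 := by
  rw [Finset.filter_product (fun a : ℕ => (N : ℤ) ∣ (l.cell p).1 - a)
    (fun b : ℕ => NearGrid N ((l.cell p).2 - b)), Finset.card_product]
  exact Nat.mul_le_mul (card_filter_dvd_sub_le_one N _) (card_filter_nearGrid_le N _)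

/-- On average over the shifts of the grid, at most three qubits in `N ^ 2` are at crossings. -/
theorem sum_card_crossings_le (N : ℕ) :
    ∑ c ∈ Finset.range N ×ˢ Finset.range N, (l.crossings N c.1 c.2).card ≤ 3 * n := by
  have h := Finset.sum_card_filter_le (Finset.range N ×ˢ Finset.range N)
    (Finset.univ : Finset (Fin n)) (fun c p =>
      (N : ℤ) ∣ (l.cell p).1 - c.1 ∧ NearGrid N ((l.cell p).2 - c.2)) 3
    fun p _ => l.card_crossings_shifts_le N p
  simpa [crossings] using h

/-- The bad qubits on a grid line or next to one. -/
def badNear (N : ℕ) (a b : ℤ) : Finset (Fin n) :=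
  l.bad.filter fun p => NearGrid N ((l.cell p).1 - a) ∨ NearGrid N ((l.cell p).2 - b)

theorem sum_card_badNear_le (N : ℕ) :
    ∑ c ∈ Finset.range N ×ˢ Finset.range N, (l.badNear N c.1 c.2).card ≤
      6 * N * l.bad.card := by
  refine Finset.sum_card_filter_le (Finset.range N ×ˢ Finset.range N) l.bad (fun c p =>
      NearGrid N ((l.cell p).1 - c.1) ∨ NearGrid N ((l.cell p).2 - c.2)) _ fun p _ => ?_
  rw [Finset.filter_or]
  refine (Finset.card_union_le _ _).trans ?_
  have h1 := Nat.mul_le_mul_right N (card_filter_nearGrid_le N (l.cell p).1)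
  have h2 := Nat.mul_le_mul_left N (card_filter_nearGrid_le N (l.cell p).2)
  have e1 : (Finset.range N ×ˢ Finset.range N).filter
      (fun c : ℕ × ℕ => NearGrid N ((l.cell p).1 - c.1)) =
      ((Finset.range N).filter fun a : ℕ => NearGrid N ((l.cell p).1 - a)) ×ˢ
        Finset.range N := by
    ext c
    simp only [Finset.mem_filter, Finset.mem_product]
    tauto
  have e2 : (Finset.range N ×ˢ Finset.range N).filter
      (fun c : ℕ × ℕ => NearGrid N ((l.cell p).2 - c.2)) =
      Finset.range N ×ˢ
        ((Finset.range N).filter fun b : ℕ => NearGrid N ((l.cell p).2 - b)) := by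
    ext c
    simp only [Finset.mem_filter, Finset.mem_product]
    tauto
  rw [e1, e2, Finset.card_product, Finset.card_product, Finset.card_range]
  linarith

/-- By averaging over the diagonal shifts, some grid has at most `2 * n / N` qubits on its lines,
so that fewer than `d` qubits are on the grid or bad. The other qubits are correctable, and so is
their complement. Hence there are no logical qubits. -/
theorem eq_zero_of_few_on_grid (hd : C.HasDistance d) (hN : 2 ≤ N)
    (hs : 4 * (N + 1) * m ≤ s) (hsd : 2 * s < d) (hbad : l.bad.card ≤ s)
    (hfew : 2 * n + N * l.bad.card < N * d) : k = 0 := by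
  have hsum : ∑ a ∈ Finset.range N, (Finset.univ.filter fun p : Fin n =>
      (N : ℤ) ∣ (l.cell p).1 - a ∨ (N : ℤ) ∣ (l.cell p).2 - a).card ≤ 2 * n := by
    have h := Finset.sum_card_filter_le (Finset.range N) (Finset.univ : Finset (Fin n))
      (fun a p => (N : ℤ) ∣ (l.cell p).1 - a ∨ (N : ℤ) ∣ (l.cell p).2 - a) 2 fun p _ => by
        rw [Finset.filter_or]
        exact (Finset.card_union_le _ _).trans (Nat.add_le_add
          (card_filter_dvd_sub_le_one N _) (card_filter_dvd_sub_le_one N _))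
    simpa using h
  obtain ⟨a, -, ha⟩ := Finset.exists_card_mul_le_sum
    (Finset.nonempty_range_iff.2 (by omega : N ≠ 0)) (fun a : ℕ =>
      (Finset.univ.filter fun p : Fin n =>
        (N : ℤ) ∣ (l.cell p).1 - a ∨ (N : ℤ) ∣ (l.cell p).2 - a).card)
  rw [Finset.card_range] at ha
  have hA := l.correctable_interior hd (by omega) hs hsd hbad a a
  have hB : Correctable C.stabSpace (l.interior N a a)ᶜ := by
    apply hd.correctable
    have hsub : (l.interior N a a)ᶜ ⊆ (Finset.univ.filter fun p : Fin n =>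
        (N : ℤ) ∣ (l.cell p).1 - a ∨ (N : ℤ) ∣ (l.cell p).2 - a) ∪ l.bad := by
      intro p hp
      rw [Finset.mem_compl, mem_interior] at hp
      simp only [Finset.mem_union, Finset.mem_filter, Finset.mem_univ, true_and]
      tauto
    have h1 := (Finset.card_le_card hsub).trans (Finset.card_union_le _ _)
    refine lt_of_mul_lt_mul_left ((Nat.mul_le_mul_left N h1).trans_lt ?_) (Nat.zero_le N)
    rw [mul_add]
    omega
  have := C.two_mul_le_of_finrank (l.interior N a a) (a := 0) (b := 0)
    (C.finrank_logicalSpan_of_correctable hA).le (C.finrank_logicalSpan_of_correctable hB).le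
  omega

/-- For fewer bad qubits than the distance, only those near the grid lines count. The others form
a correctable set whose good neighbours are in the interiors of the boxes, so they add no logical
operators to the good interiors and the bad qubits near the lines. -/
theorem le_crossings_add_badNear (hd : C.HasDistance d) (hN : 2 ≤ N)
    (hs : 4 * (N + 1) * m ≤ s) (hsd : 2 * s < d) (hbad : l.bad.card ≤ s) (a b : ℤ) :
    k ≤ (l.crossings N a b).card + 2 * (l.badNear N a b).card := by
  set A := l.interior N a b
  set D := l.badNear N a b
  set F := l.bad \ D
  have hA : Correctable C.stabSpace A := l.correctable_interior hd (by omega) hs hsd hbad a b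
  have hF : Correctable C.stabSpace F := by
    apply hd.correctable
    have : F.card ≤ l.bad.card := Finset.card_le_card Finset.sdiff_subset
    omega
  have hclean := logicalSpan_union_le C.stabSpace_le_orthogonal hF (T := A ∪ D) (by
    intro i hi q hq
    obtain ⟨p, hp, hpF⟩ := Finset.not_disjoint_iff.1 hi
    by_cases hqb : q ∈ l.bad
    · by_cases hqD : q ∈ D <;> simp [F, hqb, hqD]
    · rw [Finset.mem_sdiff] at hpF
      have hpn : ¬ (NearGrid N ((l.cell p).1 - a) ∨ NearGrid N ((l.cell p).2 - b)) :=
        fun h => hpF.2 (Finset.mem_filter.2 ⟨hpF.1, h⟩)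
      have a1 := l.adj i p hp q hq fun h => hqb h.2
      have a2 := l.adj i q hq p hp fun h => hqb h.1
      refine Finset.mem_union_right _ (Finset.mem_union_left _ ?_)
      rw [mem_interior]
      exact ⟨hqb, fun h => hpn (Or.inl (nearGrid_of_adj h (by omega) (by omega))),
        fun h => hpn (Or.inr (nearGrid_of_adj h (by omega) (by omega)))⟩)
  have h1 : Module.finrank (ZMod 2) (logicalSpan C.stabSpace (F ∪ A)) ≤
      (n - k) + 2 * D.card := by
    have hmono : logicalSpan C.stabSpace (F ∪ A) ≤ logicalSpan C.stabSpace (F ∪ (A ∪ D)) :=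
      logicalSpan_mono (Finset.union_subset_union_right Finset.subset_union_left)
    refine (Submodule.finrank_mono (hmono.trans hclean)).trans ?_
    have h := finrank_logicalSpan_union_le (S := C.stabSpace) A D
    rwa [C.finrank_logicalSpan_of_correctable hA] at h
  have h2 : Module.finrank (ZMod 2) (logicalSpan C.stabSpace (F ∪ A)ᶜ) ≤
      (n - k) + 2 * ((l.crossings N a b).card + D.card) := by
    have hsub : (F ∪ A)ᶜ ⊆ l.strips N a b ∪ (l.crossings N a b ∪ D) := by
      intro p hp
      simp only [Finset.mem_compl, Finset.mem_union, F, Finset.mem_sdiff, A, mem_interior,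
        mem_strips, mem_crossings] at hp ⊢
      by_cases hpD : p ∈ D
      · exact Or.inr (Or.inr hpD)
      · simp only [hpD, not_false_eq_true, and_true, or_false, not_or, not_and] at hp ⊢
        by_cases hx : (N : ℤ) ∣ (l.cell p).1 - a ∧ NearGrid N ((l.cell p).2 - b)
        · exact Or.inr hx
        · refine Or.inl ⟨hp.1, ?_, not_and.1 hx⟩
          by_contra h
          exact hp.2 hp.1 (fun h' => h (Or.inl h')) fun h' => h (Or.inr h')
    have h3 := l.finrank_logicalSpan_strips_union_le hd hN hs hsd a b (l.crossings N a b ∪ D)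
    have h4 := Submodule.finrank_mono (logicalSpan_mono (S := C.stabSpace) hsub)
    have h5 := Finset.card_union_le (l.crossings N a b) D
    omega
  have := C.two_mul_le_of_finrank (F ∪ A) h1 h2
  omega

theorem mul_sq_le_of_card_bad_le (hd : C.HasDistance d) (hN : 2 ≤ N)
    (hs : 4 * (N + 1) * m ≤ s) (hsd : 2 * s < d) (hbad : l.bad.card ≤ s) :
    N ^ 2 * k ≤ 3 * n + 12 * N * l.bad.card := by
  have hne : (Finset.range N ×ˢ Finset.range N).Nonempty := by
    simp only [Finset.nonempty_product, Finset.nonempty_range_iff]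
    omega
  obtain ⟨c, -, hc⟩ := Finset.exists_card_mul_le_sum hne fun c =>
    (l.crossings N c.1 c.2).card + 2 * (l.badNear N c.1 c.2).card
  rw [Finset.card_product, Finset.card_range, ← sq, Finset.sum_add_distrib,
    ← Finset.mul_sum] at hc
  have h1 := l.sum_card_crossings_le N
  have h2 := l.sum_card_badNear_le N
  have h3 := Nat.mul_le_mul_left (N ^ 2)
    (l.le_crossings_add_badNear hd hN hs hsd hbad c.1 c.2)
  linarith

theorem mul_sq_le (hd : C.HasDistance d) (hN : 2 ≤ N)
    (hs : 4 * (N + 1) * m ≤ s) (hsd : 2 * s < d) :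
    N ^ 2 * k ≤ 3 * n + 2 * N ^ 2 * l.bad.card := by
  have hne : (Finset.range N ×ˢ Finset.range N).Nonempty := by
    simp only [Finset.nonempty_product, Finset.nonempty_range_iff]
    omega
  obtain ⟨c, -, hc⟩ := Finset.exists_card_mul_le_sum hne fun c =>
    (l.crossings N c.1 c.2).card
  rw [Finset.card_product, Finset.card_range, ← sq] at hc
  have h1 := l.sum_card_crossings_le N
  obtain ⟨M, -, hM, hMcard⟩ :=
    l.exists_correctable_subset_interior hd (by omega) hs hsd c.1 c.2
  have h2 : Module.finrank (ZMod 2) (logicalSpan C.stabSpace Mᶜ) ≤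
      (n - k) + 2 * ((l.crossings N c.1 c.2).card + 2 * l.bad.card) := by
    have hsub : Mᶜ ⊆ l.strips N c.1 c.2 ∪
        (l.crossings N c.1 c.2 ∪ (l.bad ∪ (l.interior N c.1 c.2 \ M))) := by
      intro p hp
      simp only [Finset.mem_compl, Finset.mem_union, Finset.mem_sdiff, mem_interior,
        mem_strips, mem_crossings] at hp ⊢
      tauto
    have h3 := l.finrank_logicalSpan_strips_union_le hd hN hs hsd c.1 c.2
      (l.crossings N c.1 c.2 ∪ (l.bad ∪ (l.interior N c.1 c.2 \ M)))
    have h4 := Submodule.finrank_mono (logicalSpan_mono (S := C.stabSpace) hsub)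
    have h5 := Finset.card_union_le (l.crossings N c.1 c.2)
      (l.bad ∪ (l.interior N c.1 c.2 \ M))
    have h6 := Finset.card_union_le l.bad (l.interior N c.1 c.2 \ M)
    omega
  have h3 := C.two_mul_le_of_finrank M (a := 0)
    (C.finrank_logicalSpan_of_correctable hM).le h2
  have h4 : k ≤ (l.crossings N c.1 c.2).card + 2 * l.bad.card := by omega
  have h5 := Nat.mul_le_mul_left (N ^ 2) h4
  linarith

end CellLayout

/-! ### From an embedding to a cell layout -/

theorem abs_sub_apply_le_dist (x y : EuclideanSpace ℝ (Fin 2)) (i : Fin 2) :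
    |x i - y i| ≤ dist x y := by
  rw [dist_eq_norm, ← Real.norm_eq_abs]
  exact PiLp.norm_apply_le (x - y) i

namespace IsTwoDEmbedding

variable {n : ℕ} {e : Fin n → EuclideanSpace ℝ (Fin 2)}

/-- Squares of side `1 / 2` have diameter less than `1`. -/
theorem floor_injective (he : IsTwoDEmbedding e) :
    Function.Injective fun p => (⌊2 * e p 0⌋, ⌊2 * e p 1⌋) := by
  intro p q hpq
  by_contra hne
  have h := he p q hne
  obtain ⟨h0, h1⟩ := Prod.mk.inj hpq
  have a0 := Int.abs_sub_lt_one_of_floor_eq_floor h0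
  have a1 := Int.abs_sub_lt_one_of_floor_eq_floor h1
  rw [abs_lt] at a0 a1
  rw [EuclideanSpace.dist_eq, Real.le_sqrt' one_pos, Fin.sum_univ_two, Real.dist_eq,
    Real.dist_eq, sq_abs, sq_abs] at h
  nlinarith

theorem card_filter_cell_le (he : IsTwoDEmbedding e) {L : ℕ} (hL : 0 < L) (c : ℤ × ℤ) :
    (Finset.univ.filter fun p => (⌊e p 0 / L⌋, ⌊e p 1 / L⌋) = c).card ≤ 4 * L ^ 2 := by
  have hL' : (0 : ℝ) < L := by exact_mod_cast hL
  have key : ∀ (x : ℝ) (i : ℤ), ⌊x / L⌋ = i → ⌊2 * x⌋ ∈ Finset.Ico (2 * L * i) (2 * L * i + 2 * L)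
      := by
    intro x i h
    rw [Int.floor_eq_iff, le_div_iff₀ hL', div_lt_iff₀ hL'] at h
    rw [Finset.mem_Ico, Int.le_floor, Int.floor_lt]
    push_cast
    constructor <;> linarith [h.1, h.2]
  calc _ ≤ (Finset.Ico (2 * (L : ℤ) * c.1) (2 * L * c.1 + 2 * L) ×ˢ
        Finset.Ico (2 * (L : ℤ) * c.2) (2 * L * c.2 + 2 * L)).card := by
        refine Finset.card_le_card_of_injOn (fun p => (⌊2 * e p 0⌋, ⌊2 * e p 1⌋)) ?_
          he.floor_injective.injOn
        intro p hp
        simp only [Finset.coe_filter, Finset.mem_univ, true_and, Set.mem_ofPred_eq] at hp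
        obtain rfl := hp
        exact Finset.mem_coe.2 (Finset.mem_product.2 ⟨key _ _ rfl, key _ _ rfl⟩)
    _ = 4 * L ^ 2 := by
        rw [Finset.card_product, Int.card_Ico, Int.card_Ico, add_sub_cancel_left,
          add_sub_cancel_left, show (2 * (L : ℤ)).toNat = 2 * L by omega]
        ring

end IsTwoDEmbedding

namespace StabilizerCode

variable {n k : ℕ} (C : StabilizerCode n k) (e : Fin n → EuclideanSpace ℝ (Fin 2)) (ℓ : ℝ)

/-- The qubits that take part in an interaction of length at least `ℓ`. -/
noncomputable def farQubits : Finset (Fin n) := by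
  classical
  exact (C.longInteractions e ℓ).toFinset.image Prod.fst ∪
    (C.longInteractions e ℓ).toFinset.image Prod.snd

theorem mem_farQubits {p q : Fin n} (h : C.Interacts p q) (hl : ℓ ≤ dist (e p) (e q)) :
    p ∈ C.farQubits e ℓ ∧ q ∈ C.farQubits e ℓ := by
  classical
  simp only [farQubits, Finset.mem_union, Finset.mem_image, Set.mem_toFinset]
  rcases lt_or_gt_of_ne h.1 with hlt | hlt
  · have hm : (p, q) ∈ C.longInteractions e ℓ := ⟨hlt, h, hl⟩
    exact ⟨Or.inl ⟨_, hm, rfl⟩, Or.inr ⟨_, hm, rfl⟩⟩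
  · obtain ⟨hne, i, hp, hq⟩ := h
    have hm : (q, p) ∈ C.longInteractions e ℓ := ⟨hlt, ⟨hne.symm, i, hq, hp⟩, by rwa [dist_comm]⟩
    exact ⟨Or.inr ⟨_, hm, rfl⟩, Or.inl ⟨_, hm, rfl⟩⟩

theorem card_farQubits_le : (C.farQubits e ℓ).card ≤ 2 * (C.longInteractions e ℓ).ncard := by
  classical
  rw [Set.ncard_eq_toFinset_card', two_mul]
  exact (Finset.card_union_le _ _).trans (Nat.add_le_add Finset.card_image_le
    Finset.card_image_le)

variable {e ℓ}

/-- The layout on cells of side `L ≥ ℓ` in which the bad qubits are those in an interaction of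
length at least `ℓ`. -/
noncomputable def cellLayout (he : IsTwoDEmbedding e) {L : ℕ} (hL : 0 < L) (hℓ : ℓ ≤ L) :
    CellLayout C (4 * L ^ 2) where
  cell p := (⌊e p 0 / L⌋, ⌊e p 1 / L⌋)
  bad := C.farQubits e ℓ
  card_cell := he.card_filter_cell_le hL
  adj i p hp q hq hpq := by
    rcases eq_or_ne p q with rfl | hne
    · constructor <;> omega
    have hL' : (0 : ℝ) < L := by exact_mod_cast hL
    have hlt : dist (e p) (e q) < ℓ :=
      not_le.1 fun h => hpq (C.mem_farQubits e ℓ ⟨hne, i, hp, hq⟩ h)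
    have key : ∀ j : Fin 2, ⌊e p j / L⌋ ≤ ⌊e q j / L⌋ + 1 := by
      intro j
      have h1 := (le_abs_self _).trans (abs_sub_apply_le_dist (e p) (e q) j)
      rw [← Int.floor_add_one]
      refine Int.floor_le_floor ?_
      rw [div_add_one hL'.ne']
      gcongr
      linarith
    exact ⟨key 0, key 1⟩

end StabilizerCode

/-! ### Choice of the parameters -/

/-- The interaction length is `d / √n` if `k n ≤ d ^ 2` and `(k d ^ 2 / n) ^ (1 / 4)` otherwise. -/
theorem interactionLength_cases {n k d : ℝ} (hn : 0 < n) (hk : 0 < k) (hd : 0 < d)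
    (hkn : k ≤ n) (hdn : d ≤ n) (hkd : 10 ^ 8 * n ≤ k * d ^ 2) {r : ℝ}
    (hr : r = max (d / Real.sqrt n) ((k * d ^ 2 / n) ^ (1 / 4 : ℝ))) :
    100 ≤ r ∧ r ^ 2 ≤ d ∧ (k * n ≤ d ^ 2 → r ^ 2 * n = d ^ 2) ∧
      (d ^ 2 < k * n → r ^ 4 * n = k * d ^ 2 ∧ r ^ 2 ≤ k) := by
  set u : ℝ := d / Real.sqrt n with hu
  set v : ℝ := (k * d ^ 2 / n) ^ (1 / 4 : ℝ) with hv
  have hu0 : 0 ≤ u := by positivity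
  have hv0 : 0 ≤ v := by positivity
  have hu2 : u ^ 2 * n = d ^ 2 := by
    rw [hu, div_pow, Real.sq_sqrt hn.le, div_mul_cancel₀ _ hn.ne']
  have hv4 : v ^ 4 * n = k * d ^ 2 := by
    rw [hv, ← Real.rpow_natCast, ← Real.rpow_mul (by positivity)]
    norm_num
    rw [div_mul_cancel₀ _ hn.ne']
  have hv100 : 100 ≤ v := by
    refine le_of_pow_le_pow_left₀ (n := 4) (by norm_num) hv0 ?_
    refine le_of_mul_le_mul_right ?_ hn
    linarith
  have hu2d : u ^ 2 ≤ d := by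
    refine le_of_mul_le_mul_right ?_ hn
    rw [hu2, sq]
    gcongr
  have hv2d : v ^ 2 ≤ d := by
    refine le_of_pow_le_pow_left₀ (n := 2) (by norm_num) hd.le ?_
    refine le_of_mul_le_mul_right ?_ hn
    rw [← pow_mul, hv4, mul_comm]
    gcongr
  refine ⟨hr ▸ hv100.trans (le_max_right _ _), ?_, fun h => ?_, fun h => ?_⟩
  · rcases max_choice u v with h | h
    · rw [hr, h]; exact hu2d
    · rw [hr, h]; exact hv2d
  · have hvu : v ≤ u := by
      refine le_of_pow_le_pow_left₀ (n := 4) (by norm_num) hu0 ?_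
      refine le_of_mul_le_mul_right ?_ (mul_pos hn hn)
      calc v ^ 4 * (n * n) = (k * n) * d ^ 2 := by rw [← mul_assoc, hv4]; ring
        _ ≤ d ^ 2 * d ^ 2 := by gcongr
        _ = u ^ 4 * (n * n) := by rw [← hu2]; ring
    rw [hr, max_eq_left hvu, hu2]
  · have huv : u ≤ v := by
      refine le_of_pow_le_pow_left₀ (n := 4) (by norm_num) hv0 ?_
      refine le_of_mul_le_mul_right ?_ (mul_pos hn hn)
      calc u ^ 4 * (n * n) = d ^ 2 * d ^ 2 := by rw [← hu2]; ring
        _ ≤ (k * n) * d ^ 2 := by gcongr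
        _ = v ^ 4 * (n * n) := by rw [← mul_assoc, hv4]; ring
    rw [hr, max_eq_right huv]
    refine ⟨hv4, le_of_pow_le_pow_left₀ (n := 2) (by norm_num) hk.le ?_⟩
    refine le_of_mul_le_mul_right ?_ hn
    calc (v ^ 2) ^ 2 * n = k * d ^ 2 := by rw [← pow_mul, hv4]
      _ ≤ k * (k * n) := by gcongr
      _ = k ^ 2 * n := by ring

/-- The side `L` of the cells and the spacing `N` of the grid, in cells: `L` is of the order of
`r`, and `N` of the order of `d / r ^ 2`, so that a grid line of length `N` has fewer than `d`
qubits. -/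
theorem exists_grid {d : ℕ} {r : ℝ} (hr : 100 ≤ r) (hrd : r ^ 2 ≤ d) :
    ∃ L N : ℕ, 0 < L ∧ 1 / 100 * r ≤ L ∧ 2 ≤ N ∧ 4 * (N + 1) * (4 * L ^ 2) ≤ d / 4 ∧
      (d : ℝ) ≤ 1024 / 10000 * r ^ 2 * N := by
  obtain ⟨L, hLge, hLle⟩ : ∃ L : ℕ, 1 / 100 * r ≤ L ∧ (L : ℝ) ≤ 1 / 50 * r := by
    refine ⟨⌈1 / 100 * r⌉₊, Nat.le_ceil _, ?_⟩
    have := Nat.ceil_lt_add_one (show 0 ≤ 1 / 100 * r by linarith)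
    linarith
  have hLpos : 0 < L := by
    have : (0 : ℝ) < L := by linarith
    exact_mod_cast this
  have hL2 : (L : ℝ) ^ 2 ≤ 1 / 2500 * r ^ 2 := by
    calc (L : ℝ) ^ 2 ≤ (1 / 50 * r) ^ 2 := by gcongr
      _ = _ := by ring
  have hL2pos : 0 < 128 * L ^ 2 := by positivity
  have hN2 : 2 ≤ d / (128 * L ^ 2) := by
    rw [Nat.le_div_iff_mul_le hL2pos]
    have : (2 * (128 * L ^ 2) : ℝ) ≤ d := by linarith
    exact_mod_cast this
  have hNmul : d / (128 * L ^ 2) * (128 * L ^ 2) ≤ d := Nat.div_mul_le_self _ _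
  have hNlt : d < d / (128 * L ^ 2) * (128 * L ^ 2) + 128 * L ^ 2 := Nat.lt_div_mul_add hL2pos
  generalize d / (128 * L ^ 2) = N at hN2 hNmul hNlt
  refine ⟨L, N, hLpos, hLge, hN2, ?_, ?_⟩
  · rw [Nat.le_div_iff_mul_le (by norm_num)]
    refine le_trans ?_ hNmul
    nlinarith
  · have h2 : (d : ℝ) < N * (128 * L ^ 2) + 128 * L ^ 2 := by exact_mod_cast hNlt
    have h3 : (2 : ℝ) ≤ N := by exact_mod_cast hN2
    have h4 : ((N : ℝ) + 1) * (128 * L ^ 2) ≤ 2 * N * (128 * (1 / 2500 * r ^ 2)) := by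
      gcongr
      linarith
    linarith

theorem theorem1 :
    ∃ c₀ c₁ : ℝ, 0 < c₀ ∧ 0 < c₁ ∧
      ∀ (n k d : ℕ) (C : StabilizerCode n k), C.HasDistance d →
        ∀ e : Fin n → EuclideanSpace ℝ (Fin 2), IsTwoDEmbedding e →
          c₁ * (n : ℝ) ≤ (k : ℝ) * (d : ℝ) ^ 2 →
            c₀ * max (k : ℝ) (d : ℝ) ≤
              ((C.longInteractions e
                (c₀ * max ((d : ℝ) / Real.sqrt (n : ℝ))
                  (((k : ℝ) * (d : ℝ) ^ 2 / (n : ℝ)) ^ (1 / 4 : ℝ)))).ncard : ℝ) := by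
  refine ⟨1 / 100, 10 ^ 8, by norm_num, by norm_num, ?_⟩
  intro n k d C hd e he hkd
  have hkn := C.k_le
  have hdn := hd.le
  rcases Nat.eq_zero_or_pos n with rfl | hn
  · obtain rfl : k = 0 := by omega
    obtain rfl : d = 0 := by omega
    simp
  have hnR : (0 : ℝ) < n := by exact_mod_cast hn
  have hk : 0 < k := by
    refine Nat.pos_of_ne_zero fun h => ?_
    rw [h] at hkd
    norm_num at hkd
    linarith
  have hd0 : 0 < d := by
    refine Nat.pos_of_ne_zero fun h => ?_
    rw [h] at hkd
    norm_num at hkd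
    linarith
  have hkR : (0 : ℝ) < k := by exact_mod_cast hk
  have hdR : (0 : ℝ) < d := by exact_mod_cast hd0
  obtain ⟨r, hr⟩ : ∃ r, r = max ((d : ℝ) / Real.sqrt n)
    (((k : ℝ) * (d : ℝ) ^ 2 / n) ^ (1 / 4 : ℝ)) := ⟨_, rfl⟩
  rw [← hr]
  obtain ⟨hr100, hr2d, hr2, hr4⟩ := interactionLength_cases hnR hkR hdR (by exact_mod_cast hkn)
    (by exact_mod_cast hdn) hkd hr
  obtain ⟨L, N, hLpos, hLge, hN2, hs, hdN⟩ := exists_grid hr100 hr2d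
  have hsd : 2 * (d / 4) < d := by omega
  have hd4 : (d : ℝ) / 8 ≤ (d / 4 : ℕ) := by
    have h8 : 8 ≤ d := by
      have : (8 : ℝ) ≤ d := by nlinarith
      exact_mod_cast this
    have : d ≤ 8 * (d / 4) := by omega
    have : (d : ℝ) ≤ 8 * (d / 4 : ℕ) := by exact_mod_cast this
    linarith
  by_contra! hlt
  obtain ⟨l, hl⟩ : ∃ l : CellLayout C (4 * L ^ 2), l.bad = C.farQubits e (1 / 100 * r) :=
    ⟨C.cellLayout he hLpos hLge, rfl⟩
  have hbad : (l.bad.card : ℝ) < 1 / 50 * max (k : ℝ) d := by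
    have h1 : (l.bad.card : ℝ) ≤ 2 * ((C.longInteractions e (1 / 100 * r)).ncard : ℝ) := by
      rw [hl]
      exact_mod_cast C.card_farQubits_le e (1 / 100 * r)
    linarith
  have hNR : (2 : ℝ) ≤ N := by exact_mod_cast hN2
  rcases le_or_gt ((k : ℝ) * n) (d ^ 2) with hcase | hcase
  · have hkd' : (k : ℝ) ≤ d := by
      have h : (d : ℝ) * k ≤ d * d := by
        calc (d : ℝ) * k ≤ n * k := by gcongr
          _ ≤ d * d := by linarith
      exact le_of_mul_le_mul_left h hdR
    rw [max_eq_right hkd'] at hbad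
    have h1 : (n : ℝ) ≤ 1024 / 10000 * d * N := by
      have : (d : ℝ) * n ≤ d * (1024 / 10000 * d * N) := by
        calc (d : ℝ) * n ≤ (1024 / 10000 * r ^ 2 * N) * n := by gcongr
          _ = 1024 / 10000 * (r ^ 2 * n) * N := by ring
          _ = d * (1024 / 10000 * d * N) := by rw [hr2 hcase]; ring
      exact le_of_mul_le_mul_left this hdR
    refine hk.ne' (l.eq_zero_of_few_on_grid hd hN2 hs hsd ?_ ?_)
    · have : (l.bad.card : ℝ) ≤ (d / 4 : ℕ) := by linarith
      exact_mod_cast this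
    · have h2 : (N : ℝ) * l.bad.card ≤ N * (1 / 50 * d) := by gcongr
      have h3 : (0 : ℝ) < N * d := by positivity
      have : (2 * n + N * l.bad.card : ℝ) < N * d := by linarith
      exact_mod_cast this
  · obtain ⟨hr4, hr2k⟩ := hr4 hcase
    have hpos : (0 : ℝ) < N ^ 2 * k := by positivity
    have h1 : (n : ℝ) ≤ 11 / 1000 * (N ^ 2 * k) := by
      have : (d : ℝ) ^ 2 * n ≤ d ^ 2 * ((1024 / 10000) ^ 2 * (N ^ 2 * k)) := by
        calc (d : ℝ) ^ 2 * n ≤ (1024 / 10000 * r ^ 2 * N) ^ 2 * n := by gcongr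
          _ = (1024 / 10000) ^ 2 * N ^ 2 * (r ^ 4 * n) := by ring
          _ = _ := by rw [hr4]; ring
      have h3 := le_of_mul_le_mul_left this (by positivity)
      linarith
    rcases le_or_gt (k : ℝ) d with hkd' | hkd'
    · rw [max_eq_right hkd'] at hbad
      have h2 : l.bad.card ≤ d / 4 := by
        have : (l.bad.card : ℝ) ≤ (d / 4 : ℕ) := by linarith
        exact_mod_cast this
      have h3 : (N ^ 2 * k : ℝ) ≤ 3 * n + 12 * N * l.bad.card := by
        exact_mod_cast l.mul_sq_le_of_card_bad_le hd hN2 hs hsd h2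
      have h4 : (d : ℝ) ≤ 1024 / 10000 * k * N := hdN.trans (by gcongr)
      have h5 : 12 * (N : ℝ) * l.bad.card ≤ 12 * N * (1 / 50 * (1024 / 10000 * k * N)) := by
        gcongr
        linarith
      have h6 : 12 * (N : ℝ) * (1 / 50 * (1024 / 10000 * k * N)) =
        12 / 50 * (1024 / 10000) * (N ^ 2 * k) := by ring
      linarith
    · rw [max_eq_left hkd'.le] at hbad
      have h3 : (N ^ 2 * k : ℝ) ≤ 3 * n + 2 * N ^ 2 * l.bad.card := by
        exact_mod_cast l.mul_sq_le hd hN2 hs hsd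
      have h4 : 2 * (N : ℝ) ^ 2 * l.bad.card ≤ 2 * N ^ 2 * (1 / 50 * k) := by gcongr
      linarith
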